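/- Let $S^2\subset\mathbb R^3$ be the unit sphere, identified with the Riemann sphere $\hat{\mathbb C}=\mathbb C\cup\{\infty\}$ by stereographic projection $\kappa$ from the north pole, and let $\mathcal M=\mathrm{SL}(2,\mathbb C)/\{\pm I\}$ be the group of Möbius transformations $\zeta\mapsto\frac{a\zeta+b}{c\zeta+d}$, $ad-bc=1$, regarded as a real analytic Lie group; it is identified with the proper orthochronous Lorentz group and acts on $S^2$ through $\kappa$. For $f\in\mathcal M$ represented by $\begin{pmatrix}a&b\\c&d\end{pmatrix}$ the conformal factor of $f$ at the point $\mathbf z=\kappa^{-1}(\zeta)$ is $$K_f(\mathbf z)=\frac{1+|\zeta|^2}{|a\zeta+b|^2+|c\zeta+d|^2}\quad(\zeta\in\mathbb C),\qquad K_f(\kappa^{-1}(\infty))=\frac1{|a|^2+|c|^2}.$$ Let $\mathcal S=C^\infty(S^2,\mathbb R)$ be the Fréchet space of supertranslations, with the compact-open $C^\infty$-topology, and let $$\sigma:\mathcal S\times\mathcal M\to\mathcal S,\qquad \sigma(\alpha,f)=K_f^{-1}\cdot(\alpha\circ f),$$ which is a right action of $\mathcal M$ on $\mathcal S$ by linear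 maps. The BMS group is the semidirect product $\mathrm{BMS}=\mathcal S\rtimes_\sigma\mathcal M$, that is, the Fréchet manifold $\mathcal S\times\mathcal M$ with the product $$(F,\varphi)\,(G,\psi)=(F+\sigma(G,\varphi),\ \psi\circ\varphi).$$ Smooth maps between open subsets of locally convex spaces over $\mathbb R$ or $\mathbb C$ are understood in the sense of Bastiani: all iterated directional derivatives exist and are jointly continuous in the point and the directions. A map $f:U\to F$ on an open subset $U$ of a real locally convex space $E$ is real analytic if it extends to a complex smooth (holomorphic) map $\tilde U\to F_{\mathbb C}$ on an open neighbourhood $\tilde U$ of $U$ in the complexification $E_{\mathbb C}$. Real analytic maps between real analytic manifolds are the continuous maps that are real analytic in charts, and a real analytic Lie group is a group with a real analytic manifold structure for which multiplication and inversion are real analytic. **Proposition.** 1. The action $\sigma:\mathcal S\times\mathcal M\to\mathcal S$ is not real analytic. 2. The BMS group is not a real analytic Lie group: the multiplication of $\mathrm{BMS}$ is not real analytic with respect to the product real analytic manifold structure of $\mathcal S\times\mathcal M$. Moreover, no real analytic manifold structure on $\mathrm{BMS}$ that is compatible with its smooth Fréchet manifold structure makes $\mathrm{BMS}$ a real analytic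 Lie group. -/

import Mathlib

open Filter Set
open scoped Manifold ContDiff MatrixGroups Topology

noncomputable section

namespace BMS

/-! ### Calculus in locally convex spaces -/

section Calculus

/-- `f` is a `C^∞` map over `𝕜` on the open set `U`, in the sense of Bastiani: the iterated
directional derivatives `d k x (y₁, …, y_k) = (D_{y_k} ⋯ D_{y_1} f)(x)` of all orders exist at the
points of `U` and define continuous maps on `U × E^k`. Over `ℂ` such maps are the holomorphic
ones. -/
def SmoothOn (𝕜 : Type*) [NontriviallyNormedField 𝕜] {E F : Type*}
    [AddCommGroup E] [Module 𝕜 E] [TopologicalSpace E]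
    [AddCommGroup F] [Module 𝕜 F] [TopologicalSpace F] (f : E → F) (U : Set E) : Prop :=
  IsOpen U ∧ ∃ d : (k : ℕ) → E → (Fin k → E) → F,
    (∀ x ∈ U, ∀ y, d 0 x y = f x) ∧
    (∀ k, ∀ x ∈ U, ∀ y : Fin (k + 1) → E,
      Tendsto (fun t : 𝕜 => t⁻¹ • (d k (x + t • y (Fin.last k)) (fun i => y i.castSucc)
          - d k x (fun i => y i.castSucc))) (𝓝[≠] 0) (𝓝 (d (k + 1) x y))) ∧
    (∀ k, ContinuousOn (fun p : E × (Fin k → E) => d k p.1 p.2) (U ×ˢ univ))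

/-- The complexification `E × E` of a real topological vector space `E`; the pair `(u, v)`
stands for `u + i v`. -/
def Complexification (E : Type*) : Type _ := E × E

namespace Complexification

variable {E : Type*}

instance [AddCommGroup E] : AddCommGroup (Complexification E) :=
  inferInstanceAs (AddCommGroup (E × E))

instance [TopologicalSpace E] : TopologicalSpace (Complexification E) :=
  inferInstanceAs (TopologicalSpace (E × E))

/-- `(x + i y) • (u, v) = (x u - y v, x v + y u)`. -/
instance [AddCommGroup E] [Module ℝ E] : SMul ℂ (Complexification E) :=
  ⟨fun c w => ((c.re • w.1 - c.im • w.2, c.re • w.2 + c.im • w.1) : E × E)⟩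

theorem smul_def [AddCommGroup E] [Module ℝ E] (c : ℂ) (w : Complexification E) :
    c • w = ((c.re • w.1 - c.im • w.2, c.re • w.2 + c.im • w.1) : E × E) := rfl

instance [AddCommGroup E] [Module ℝ E] : Module ℂ (Complexification E) where
  one_smul w := by
    rw [smul_def]
    exact Prod.ext (by simp) (by simp)
  mul_smul c d w := by
    simp only [smul_def, Complex.mul_re, Complex.mul_im]
    exact Prod.ext
      (by change (c.re * d.re - c.im * d.im) • w.1 - (c.re * d.im + c.im * d.re) • w.2
            = c.re • (d.re • w.1 - d.im • w.2) - c.im • (d.re • w.2 + d.im • w.1); module)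
      (by change (c.re * d.re - c.im * d.im) • w.2 + (c.re * d.im + c.im * d.re) • w.1
            = c.re • (d.re • w.2 + d.im • w.1) + c.im • (d.re • w.1 - d.im • w.2); module)
  smul_zero c := by
    rw [smul_def]
    exact Prod.ext (by change c.re • (0 : E) - c.im • (0 : E) = 0; simp)
      (by change c.re • (0 : E) + c.im • (0 : E) = 0; simp)
  smul_add c w w' := by
    simp only [smul_def]
    exact Prod.ext
      (by change c.re • (w.1 + w'.1) - c.im • (w.2 + w'.2)
            = (c.re • w.1 - c.im • w.2) + (c.re • w'.1 - c.im • w'.2); module)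
      (by change c.re • (w.2 + w'.2) + c.im • (w.1 + w'.1)
            = (c.re • w.2 + c.im • w.1) + (c.re • w'.2 + c.im • w'.1); module)
  add_smul c d w := by
    simp only [smul_def, Complex.add_re, Complex.add_im]
    exact Prod.ext
      (by change (c.re + d.re) • w.1 - (c.im + d.im) • w.2
            = (c.re • w.1 - c.im • w.2) + (d.re • w.1 - d.im • w.2); module)
      (by change (c.re + d.re) • w.2 + (c.im + d.im) • w.1
            = (c.re • w.2 + c.im • w.1) + (d.re • w.2 + d.im • w.1); module)
  zero_smul w := by
    rw [smul_def]
    exact Prod.ext (by simp only [Complex.zero_re, Complex.zero_im, zero_smul, sub_zero]; rfl)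
      (by simp only [Complex.zero_re, Complex.zero_im, zero_smul, add_zero]; rfl)

/-- The inclusion of `E` in its complexification. -/
def ofReal [Zero E] (x : E) : Complexification E := ((x, 0) : E × E)

end Complexification

open Complexification in
/-- `f` is real analytic on the open set `U`: it extends to a holomorphic map on an open
neighbourhood of `U` in the complexification. -/
def RealAnalyticOn {E F : Type*} [AddCommGroup E] [Module ℝ E] [TopologicalSpace E]
    [AddCommGroup F] [Module ℝ F] [TopologicalSpace F] (f : E → F) (U : Set E) : Prop :=
  ∃ (V : Set (Complexification E)) (g : Complexification E → Complexification F),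
    (∀ x ∈ U, ofReal x ∈ V ∧ g (ofReal x) = ofReal (f x)) ∧ SmoothOn ℂ g V

end Calculus

/-! ### Manifolds and Lie groups modelled on locally convex spaces, given by their atlases -/

section Manifolds

variable {M N E F : Type*} [TopologicalSpace M] [TopologicalSpace N]
  [AddCommGroup E] [Module ℝ E] [TopologicalSpace E]
  [AddCommGroup F] [Module ℝ F] [TopologicalSpace F]

/-- A real analytic atlas on `M`. -/
structure IsRealAnalyticAtlas (A : Set (OpenPartialHomeomorph M E)) : Prop where
  covers : ∀ x : M, ∃ e ∈ A, x ∈ e.source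
  compatible : ∀ e ∈ A, ∀ e' ∈ A, RealAnalyticOn (e.symm.trans e') (e.symm.trans e').source

/-- The charts of the two atlases are related by smooth coordinate changes. -/
def SmoothlyCompatible (A B : Set (OpenPartialHomeomorph M E)) : Prop :=
  ∀ e ∈ A, ∀ e' ∈ B, SmoothOn ℝ (e.symm.trans e') (e.symm.trans e').source ∧
    SmoothOn ℝ (e'.symm.trans e) (e'.symm.trans e).source

/-- The product atlas. -/
def prodAtlas (A : Set (OpenPartialHomeomorph M E)) (B : Set (OpenPartialHomeomorph N F)) :
    Set (OpenPartialHomeomorph (M × N) (E × F)) :=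
  {c | ∃ e ∈ A, ∃ e' ∈ B, c = e.prod e'}

/-- The atlas of a locally convex space, consisting of the identity. -/
def modelAtlas (E : Type*) [TopologicalSpace E] : Set (OpenPartialHomeomorph E E) :=
  {OpenPartialHomeomorph.refl E}

/-- A map between manifolds is real analytic if it is continuous and real analytic in all
charts. -/
def RealAnalyticMap (A : Set (OpenPartialHomeomorph M E)) (B : Set (OpenPartialHomeomorph N F))
    (f : M → N) : Prop :=
  Continuous f ∧ ∀ e ∈ A, ∀ e' ∈ B,
    RealAnalyticOn (fun x => e' (f (e.symm x))) (e.target ∩ e.symm ⁻¹' (f ⁻¹' e'.source))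

/-- The atlas `A` makes the group `G` a real analytic Lie group. -/
structure IsRealAnalyticLieGroup {G : Type*} [TopologicalSpace G] [Group G]
    (A : Set (OpenPartialHomeomorph G E)) : Prop where
  atlas : IsRealAnalyticAtlas A
  mul : RealAnalyticMap (prodAtlas A A) A (fun p : G × G => p.1 * p.2)
  inv : RealAnalyticMap A A (fun x : G => x⁻¹)

end Manifolds

/-! ### The sphere and the Riemann sphere -/

/-- The unit sphere in `ℝ³`. -/
abbrev Sphere : Type := Metric.sphere (0 : EuclideanSpace ℝ (Fin 3)) 1

/-- The point of the unit sphere in `ℝ³` with the homogeneous coordinates `[p : q]`. -/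
def hopf (p q : ℂ) : EuclideanSpace ℝ (Fin 3) :=
  !₂[2 * (p.re * q.re + p.im * q.im) / (Complex.normSq p + Complex.normSq q),
    2 * (p.im * q.re - p.re * q.im) / (Complex.normSq p + Complex.normSq q),
    (Complex.normSq p - Complex.normSq q) / (Complex.normSq p + Complex.normSq q)]

theorem normSq_add_pos {p q : ℂ} (h : p ≠ 0 ∨ q ≠ 0) :
    0 < Complex.normSq p + Complex.normSq q := by
  rcases h with h | h
  · exact add_pos_of_pos_of_nonneg (Complex.normSq_pos.2 h) (Complex.normSq_nonneg _)
  · exact add_pos_of_nonneg_of_pos (Complex.normSq_nonneg _) (Complex.normSq_pos.2 h)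

theorem mem_sphere_iff (x : EuclideanSpace ℝ (Fin 3)) :
    x ∈ Metric.sphere (0 : EuclideanSpace ℝ (Fin 3)) 1 ↔ x 0 ^ 2 + x 1 ^ 2 + x 2 ^ 2 = 1 := by
  rw [mem_sphere_zero_iff_norm, EuclideanSpace.norm_eq, Real.sqrt_eq_one]
  simp [Fin.sum_univ_three]

theorem hopf_mem {p q : ℂ} (h : p ≠ 0 ∨ q ≠ 0) :
    hopf p q ∈ Metric.sphere (0 : EuclideanSpace ℝ (Fin 3)) 1 := by
  rw [mem_sphere_iff]
  have h0 := (normSq_add_pos h).ne'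
  change (2 * (p.re * q.re + p.im * q.im) / (Complex.normSq p + Complex.normSq q)) ^ 2
    + (2 * (p.im * q.re - p.re * q.im) / (Complex.normSq p + Complex.normSq q)) ^ 2
    + ((Complex.normSq p - Complex.normSq q) / (Complex.normSq p + Complex.normSq q)) ^ 2 = 1
  rw [div_pow, div_pow, div_pow, ← add_div, ← add_div, div_eq_one_iff_eq (pow_ne_zero 2 h0)]
  simp only [Complex.normSq_apply]
  ring

theorem hopf_mul (c p q : ℂ) (hc : c ≠ 0) : hopf (c * p) (c * q) = hopf p q := by
  have h0 : Complex.normSq c ≠ 0 := (Complex.normSq_pos.2 hc).ne'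
  have e : Complex.normSq (c * p) + Complex.normSq (c * q)
      = Complex.normSq c * (Complex.normSq p + Complex.normSq q) := by
    simp only [map_mul]; ring
  have key : ∀ u v : ℝ, u = Complex.normSq c * v →
      u / (Complex.normSq (c * p) + Complex.normSq (c * q))
        = v / (Complex.normSq p + Complex.normSq q) := by
    intro u v h
    rw [e, h, mul_div_mul_left _ _ h0]
  unfold hopf
  rw [key _ (2 * (p.re * q.re + p.im * q.im)), key _ (2 * (p.im * q.re - p.re * q.im)),
    key _ (Complex.normSq p - Complex.normSq q)] <;>
  · simp only [Complex.normSq_apply, Complex.mul_re, Complex.mul_im]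
    ring

/-- Stereographic projection from the north pole `(0, 0, 1)`; in spherical coordinates
`(θ, φ) ↦ exp (i φ) cot (θ / 2)`, and the north pole is sent to `∞`. -/
def kappaFun (z : Sphere) : OnePoint ℂ :=
  if z.1 2 = 1 then OnePoint.infty
  else ((⟨z.1 0 / (1 - z.1 2), z.1 1 / (1 - z.1 2)⟩ : ℂ) : OnePoint ℂ)

/-- The inverse of stereographic projection. -/
def kappaInv (w : OnePoint ℂ) : Sphere :=
  w.elim ⟨hopf 1 0, hopf_mem (Or.inl one_ne_zero)⟩
    (fun ζ => ⟨hopf ζ 1, hopf_mem (Or.inr one_ne_zero)⟩)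

/-- The identification `κ` of the sphere with the Riemann sphere `ℂ ∪ {∞}`. -/
def kappa : Sphere ≃ OnePoint ℂ where
  toFun := kappaFun
  invFun := kappaInv
  left_inv z := by
    have hz := (mem_sphere_iff z.1).1 z.2
    apply Subtype.ext
    unfold kappaFun
    split_ifs with h
    · have h0 : z.1 0 = 0 := by rw [h] at hz; nlinarith [sq_nonneg (z.1 0), sq_nonneg (z.1 1)]
      have h1 : z.1 1 = 0 := by rw [h] at hz; nlinarith [sq_nonneg (z.1 0), sq_nonneg (z.1 1)]
      ext i
      fin_cases i <;> simp [kappaInv, hopf, h0, h1, h]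
    · have h' : 1 - z.1 2 ≠ 0 := sub_ne_zero.2 (Ne.symm h)
      have e : (z.1 0 / (1 - z.1 2)) * (z.1 0 / (1 - z.1 2))
          + (z.1 1 / (1 - z.1 2)) * (z.1 1 / (1 - z.1 2)) = (1 + z.1 2) / (1 - z.1 2) := by
        field_simp
        linarith
      have e1 : (1 + z.1 2) / (1 - z.1 2) + 1 = 2 / (1 - z.1 2) := by field_simp; ring
      have e2 : (1 + z.1 2) / (1 - z.1 2) - 1 = 2 * z.1 2 / (1 - z.1 2) := by field_simp; ring
      ext i
      fin_cases i <;> simp [kappaInv, hopf, Complex.normSq_apply, e, e1, e2] <;> field_simp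
  right_inv w := by
    induction w using OnePoint.rec with
    | infty => simp [kappaInv, kappaFun, hopf]
    | coe ζ =>
      have h0 : Complex.normSq ζ + 1 ≠ 0 := by linarith [Complex.normSq_nonneg ζ]
      have h1 : (Complex.normSq ζ - 1) / (Complex.normSq ζ + 1) ≠ 1 := by
        intro h
        rw [div_eq_one_iff_eq h0] at h
        linarith
      have e : 1 - (Complex.normSq ζ - 1) / (Complex.normSq ζ + 1)
          = 2 / (Complex.normSq ζ + 1) := by field_simp; ring
      simp only [kappaInv, kappaFun, hopf, OnePoint.elim_some]
      simp [h1, e]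
      apply Complex.ext <;> simp <;> field_simp

/-! ### The Lorentz group as the group of Möbius transformations -/

/-- The proper orthochronous Lorentz group, realised as the Möbius group
`SL(2, ℂ) / {± 1} = PSL(2, ℂ)` with the quotient topology. -/
abbrev Lor : Type := PSL(2, ℂ)

theorem eq_or_eq_neg_of_inv_mul_mem {A B : SL(2, ℂ)}
    (h : A⁻¹ * B ∈ Subgroup.center SL(2, ℂ)) : B = A ∨ B = -A := by
  rw [Matrix.SpecialLinearGroup.mem_center_iff] at h
  obtain ⟨r, hr, hrA⟩ := h
  have hB : (B : Matrix (Fin 2) (Fin 2) ℂ) = A * Matrix.scalar (Fin 2) r := by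
    rw [hrA, ← Matrix.SpecialLinearGroup.coe_mul, mul_inv_cancel_left]
  have hr' : r = 1 ∨ r = -1 := sq_eq_one_iff.1 (by simpa using hr)
  rcases hr' with rfl | rfl
  · left
    apply Subtype.ext
    rw [hB, map_one, mul_one]
  · right
    apply Subtype.ext
    rw [hB, map_neg, map_one, mul_neg, mul_one]
    rfl

/-- The homogeneous coordinates of a point of the Riemann sphere. -/
def homCoord (w : OnePoint ℂ) : ℂ × ℂ := w.elim (1, 0) (fun ζ => (ζ, 1))

theorem homCoord_ne (w : OnePoint ℂ) : (homCoord w).1 ≠ 0 ∨ (homCoord w).2 ≠ 0 := by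
  induction w using OnePoint.rec <;> simp [homCoord]

theorem hopf_homCoord (z : Sphere) : hopf (homCoord (kappa z)).1 (homCoord (kappa z)).2 = z.1 := by
  conv_rhs => rw [← kappa.symm_apply_apply z]
  generalize kappa z = w
  induction w using OnePoint.rec <;> rfl

theorem mul_homCoord_ne (A : SL(2, ℂ)) {p q : ℂ} (h : p ≠ 0 ∨ q ≠ 0) :
    A 0 0 * p + A 0 1 * q ≠ 0 ∨ A 1 0 * p + A 1 1 * q ≠ 0 := by
  by_contra! hc
  have hd := A.2
  rw [Matrix.det_fin_two] at hd
  obtain ⟨h1, h2⟩ := hc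
  have hp : p = 0 := by linear_combination (-p) * hd + A 1 1 * h1 - A 0 1 * h2
  have hq : q = 0 := by linear_combination (-q) * hd + A 0 0 * h2 - A 1 0 * h1
  simp [hp, hq] at h

/-- The Möbius transformations `ζ ↦ (a ζ + b) / (c ζ + d)` of the Riemann sphere, transported to
the sphere by `κ`. -/
def slAct : SL(2, ℂ) →* Equiv.Perm Sphere :=
  (kappa.symm.permCongrHom.toMonoidHom).comp
    ((MulAction.toPermHom (GL (Fin 2) ℂ) (OnePoint ℂ)).comp Matrix.SpecialLinearGroup.toGL)

theorem slAct_apply (A : SL(2, ℂ)) (z : Sphere) :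
    slAct A z = kappa.symm (Matrix.SpecialLinearGroup.toGL A • kappa z) := rfl

theorem kappa_symm_smul (A : SL(2, ℂ)) (w : OnePoint ℂ) :
    (kappa.symm (Matrix.SpecialLinearGroup.toGL A • w)).1
      = hopf (A 0 0 * (homCoord w).1 + A 0 1 * (homCoord w).2)
          (A 1 0 * (homCoord w).1 + A 1 1 * (homCoord w).2) := by
  have hne := mul_homCoord_ne A (homCoord_ne w)
  have main : ∀ p q : ℂ, p ≠ 0 ∨ q ≠ 0 →
      (kappaInv (if q = 0 then OnePoint.infty else ((p / q : ℂ) : OnePoint ℂ))).1 = hopf p q := by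
    intro p q h
    split_ifs with hq
    · subst hq
      have hp : p ≠ 0 := by simpa using h
      have := hopf_mul p 1 0 hp
      rw [mul_one, mul_zero] at this
      exact this.symm
    · have := hopf_mul q (p / q) 1 hq
      rw [mul_one, mul_div_cancel₀ _ hq] at this
      exact this.symm
  rw [← main _ _ hne]
  induction w using OnePoint.rec with
  | infty => rw [OnePoint.smul_infty_eq_ite]; simp [homCoord]; rfl
  | coe ζ => rw [OnePoint.smul_some_eq_ite]; simp [homCoord]; rfl

theorem slAct_val (A : SL(2, ℂ)) (z : Sphere) :
    (slAct A z).1 = hopf (A 0 0 * (homCoord (kappa z)).1 + A 0 1 * (homCoord (kappa z)).2)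
      (A 1 0 * (homCoord (kappa z)).1 + A 1 1 * (homCoord (kappa z)).2) :=
  kappa_symm_smul A (kappa z)

theorem slAct_neg (A : SL(2, ℂ)) : slAct (-A) = slAct A := by
  ext1 z
  apply Subtype.ext
  rw [slAct_val, slAct_val, ← hopf_mul (-1) _ _ (neg_ne_zero.2 one_ne_zero)]
  congr 1 <;> · simp; ring

theorem center_le_ker_slAct : Subgroup.center SL(2, ℂ) ≤ slAct.ker := by
  intro A hA
  rw [MonoidHom.mem_ker]
  rcases eq_or_eq_neg_of_inv_mul_mem (A := 1) (B := A) (by simpa using hA) with rfl | rfl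
  · exact map_one _
  · rw [slAct_neg, map_one]

/-- The action of the Lorentz group on the sphere by conformal transformations. -/
def lorAct : Lor →* Equiv.Perm Sphere :=
  QuotientGroup.lift (Subgroup.center SL(2, ℂ)) slAct center_le_ker_slAct

/-- The conformal factor of a Möbius transformation at a point of the Riemann sphere. -/
def slFactor (A : SL(2, ℂ)) (w : OnePoint ℂ) : ℝ :=
  w.elim (1 / (‖A 0 0‖ ^ 2 + ‖A 1 0‖ ^ 2))
    (fun ζ => (1 + ‖ζ‖ ^ 2) / (‖A 0 0 * ζ + A 0 1‖ ^ 2 + ‖A 1 0 * ζ + A 1 1‖ ^ 2))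

theorem slFactor_eq (A : SL(2, ℂ)) (w : OnePoint ℂ) :
    slFactor A w = (Complex.normSq (homCoord w).1 + Complex.normSq (homCoord w).2) /
      (Complex.normSq (A 0 0 * (homCoord w).1 + A 0 1 * (homCoord w).2)
        + Complex.normSq (A 1 0 * (homCoord w).1 + A 1 1 * (homCoord w).2)) := by
  induction w using OnePoint.rec with
  | infty => simp [slFactor, homCoord, Complex.normSq_eq_norm_sq]
  | coe ζ => simp [slFactor, homCoord, Complex.normSq_eq_norm_sq, add_comm]

theorem slFactor_neg (A : SL(2, ℂ)) (w : OnePoint ℂ) : slFactor (-A) w = slFactor A w := by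
  rw [slFactor_eq, slFactor_eq,
    ← Complex.normSq_neg (A 0 0 * (homCoord w).1 + A 0 1 * (homCoord w).2),
    ← Complex.normSq_neg (A 1 0 * (homCoord w).1 + A 1 1 * (homCoord w).2)]
  congr 3 <;> · simp; ring

/-- The conformal factor `K_f(z)` of a Lorentz transformation `f` at a point `z` of the sphere. -/
def confFactor (f : Lor) (z : Sphere) : ℝ :=
  Quotient.liftOn' f (fun A => slFactor A (kappa z)) (by
    intro A B h
    rcases eq_or_eq_neg_of_inv_mul_mem (QuotientGroup.leftRel_apply.1 h) with rfl | rfl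
    · rfl
    · exact (slFactor_neg A _).symm)

theorem confFactor_mk (A : SL(2, ℂ)) (z : Sphere) :
    confFactor (QuotientGroup.mk A) z = slFactor A (kappa z) := rfl

theorem lorAct_mk (A : SL(2, ℂ)) (z : Sphere) : lorAct (QuotientGroup.mk A) z = slAct A z := rfl

/-- The polynomial `|a p + b q|² / (|p|² + |q|²)` in the point `x` with homogeneous coordinates
`[p : q]`. -/
def hermPoly (a b : ℂ) (x : EuclideanSpace ℝ (Fin 3)) : ℝ :=
  (Complex.normSq a * (1 + x 2) + Complex.normSq b * (1 - x 2)) / 2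
    + ((a * (starRingEnd ℂ) b).re * x 0 - (a * (starRingEnd ℂ) b).im * x 1)

theorem hermPoly_hopf (a b : ℂ) {p q : ℂ} (h : p ≠ 0 ∨ q ≠ 0) :
    hermPoly a b (hopf p q)
      = Complex.normSq (a * p + b * q) / (Complex.normSq p + Complex.normSq q) := by
  have h0 := (normSq_add_pos h).ne'
  have e0 : hopf p q 0
    = 2 * (p.re * q.re + p.im * q.im) / (Complex.normSq p + Complex.normSq q) := rfl
  have e1 : hopf p q 1
    = 2 * (p.im * q.re - p.re * q.im) / (Complex.normSq p + Complex.normSq q) := rfl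
  have e2 : hopf p q 2
    = (Complex.normSq p - Complex.normSq q) / (Complex.normSq p + Complex.normSq q) := rfl
  rw [hermPoly, e0, e1, e2, eq_div_iff h0]
  field_simp
  simp only [Complex.normSq_apply, Complex.add_re, Complex.add_im, Complex.mul_re, Complex.mul_im,
    Complex.conj_re, Complex.conj_im]
  ring

theorem contDiff_hermPoly (a b : ℂ) : ContDiff ℝ ∞ (hermPoly a b) := by
  unfold hermPoly
  fun_prop

theorem inv_slFactor (A : SL(2, ℂ)) (z : Sphere) :
    (slFactor A (kappa z))⁻¹ = hermPoly (A 0 0) (A 0 1) z.1 + hermPoly (A 1 0) (A 1 1) z.1 := by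
  rw [slFactor_eq, inv_div, ← hopf_homCoord z, hermPoly_hopf _ _ (homCoord_ne _),
    hermPoly_hopf _ _ (homCoord_ne _), add_div]

theorem slFactor_pos (A : SL(2, ℂ)) (w : OnePoint ℂ) : 0 < slFactor A w := by
  rw [slFactor_eq]
  exact div_pos (normSq_add_pos (homCoord_ne w)) (normSq_add_pos (mul_homCoord_ne A (homCoord_ne w)))

/-- The numerators of the coordinates of the image point. -/
def actPoly (A : SL(2, ℂ)) (x : EuclideanSpace ℝ (Fin 3)) : Fin 3 → ℝ :=
  ![(hermPoly (A 0 0 + A 1 0) (A 0 1 + A 1 1) x - hermPoly (A 0 0 - A 1 0) (A 0 1 - A 1 1) x) / 2,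
    (hermPoly (A 0 0 + Complex.I * A 1 0) (A 0 1 + Complex.I * A 1 1) x
      - hermPoly (A 0 0 - Complex.I * A 1 0) (A 0 1 - Complex.I * A 1 1) x) / 2,
    hermPoly (A 0 0) (A 0 1) x - hermPoly (A 1 0) (A 1 1) x]

theorem slAct_coord (A : SL(2, ℂ)) (z : Sphere) (i : Fin 3) :
    (slAct A z).1 i = slFactor A (kappa z) * actPoly A z.1 i := by
  rw [slAct_val, slFactor_eq]
  have hz := homCoord_ne (kappa z)
  have hne := mul_homCoord_ne A hz
  rw [← hopf_homCoord z]
  have h0 := (normSq_add_pos hz).ne'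
  have h1 := (normSq_add_pos hne).ne'
  generalize (homCoord (kappa z)).1 = p at *
  generalize (homCoord (kappa z)).2 = q at *
  rw [div_mul_eq_mul_div, eq_div_iff h1]
  fin_cases i
  · change 2 * _ / _ * _ = _ * ((_ - _) / 2)
    rw [div_mul_cancel₀ _ h1, hermPoly_hopf _ _ hz, hermPoly_hopf _ _ hz]
    field_simp
    simp only [Complex.normSq_apply, Complex.add_re, Complex.add_im, Complex.mul_re,
      Complex.mul_im, Complex.sub_re, Complex.sub_im]
    ring
  · change 2 * _ / _ * _ = _ * ((_ - _) / 2)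
    rw [div_mul_cancel₀ _ h1, hermPoly_hopf _ _ hz, hermPoly_hopf _ _ hz]
    field_simp
    simp only [Complex.normSq_apply, Complex.add_re, Complex.add_im, Complex.mul_re,
      Complex.mul_im, Complex.sub_re, Complex.sub_im, Complex.I_re, Complex.I_im]
    ring
  · change (_ - _) / _ * _ = _ * (_ - _)
    rw [div_mul_cancel₀ _ h1, hermPoly_hopf _ _ hz, hermPoly_hopf _ _ hz]
    field_simp

theorem contMDiff_inv_slFactor (A : SL(2, ℂ)) :
    ContMDiff (𝓡 2) 𝓘(ℝ, ℝ) ∞ (fun z : Sphere => (slFactor A (kappa z))⁻¹) := by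
  have : Fact (Module.finrank ℝ (EuclideanSpace ℝ (Fin 3)) = 2 + 1) := ⟨by simp⟩
  have h : (fun z : Sphere => (slFactor A (kappa z))⁻¹)
      = (fun x => hermPoly (A 0 0) (A 0 1) x + hermPoly (A 1 0) (A 1 1) x) ∘
        ((↑) : Sphere → EuclideanSpace ℝ (Fin 3)) := funext (inv_slFactor A)
  rw [h]
  exact (((contDiff_hermPoly _ _).add (contDiff_hermPoly _ _)).contMDiff).comp
    contMDiff_coe_sphere

theorem contMDiff_slAct (A : SL(2, ℂ)) : ContMDiff (𝓡 2) (𝓡 2) ∞ (fun z : Sphere => slAct A z) := by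
  have : Fact (Module.finrank ℝ (EuclideanSpace ℝ (Fin 3)) = 2 + 1) := ⟨by simp⟩
  have h : ContMDiff (𝓡 2) 𝓘(ℝ, EuclideanSpace ℝ (Fin 3)) ∞
      (fun z : Sphere => (slAct A z).1) := by
    intro z
    have e : (fun z : Sphere => (slAct A z).1)
        = (fun x : EuclideanSpace ℝ (Fin 3) => (WithLp.toLp 2 fun i =>
            (hermPoly (A 0 0) (A 0 1) x + hermPoly (A 1 0) (A 1 1) x)⁻¹ * actPoly A x i :
              EuclideanSpace ℝ (Fin 3))) ∘ ((↑) : Sphere → EuclideanSpace ℝ (Fin 3)) := by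
      funext z
      ext i
      simp only [Function.comp]
      rw [slAct_coord, ← inv_slFactor, inv_inv]
    rw [e]
    refine ContMDiffAt.comp z (ContDiffAt.contMDiffAt ?_) (contMDiff_coe_sphere z)
    have hne : hermPoly (A 0 0) (A 0 1) z.1 + hermPoly (A 1 0) (A 1 1) z.1 ≠ 0 := by
      rw [← inv_slFactor]
      exact inv_ne_zero (slFactor_pos A _).ne'
    rw [contDiffAt_euclidean]
    intro i
    refine ContDiffAt.mul (ContDiffAt.inv ((contDiff_hermPoly _ _).add
      (contDiff_hermPoly _ _)).contDiffAt hne) ?_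
    fin_cases i
    · exact (((contDiff_hermPoly _ _).sub (contDiff_hermPoly _ _)).div_const 2).contDiffAt
    · exact (((contDiff_hermPoly _ _).sub (contDiff_hermPoly _ _)).div_const 2).contDiffAt
    · exact ((contDiff_hermPoly _ _).sub (contDiff_hermPoly _ _)).contDiffAt
  exact h.codRestrict_sphere (fun z => (slAct A z).2)

theorem contMDiff_lorAct (f : Lor) : ContMDiff (𝓡 2) (𝓡 2) ∞ (fun z : Sphere => lorAct f z) := by
  induction f using QuotientGroup.induction_on with
  | H A => exact contMDiff_slAct A

theorem contMDiff_inv_confFactor (f : Lor) :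
    ContMDiff (𝓡 2) 𝓘(ℝ, ℝ) ∞ (fun z : Sphere => (confFactor f z)⁻¹) := by
  induction f using QuotientGroup.induction_on with
  | H A => exact contMDiff_inv_slFactor A

theorem confFactor_one (z : Sphere) : confFactor 1 z = 1 := by
  change slFactor 1 (kappa z) = 1
  rw [slFactor_eq]
  simp [(normSq_add_pos (homCoord_ne (kappa z))).ne']

/-- The chain rule for the conformal factor. -/
theorem confFactor_mul (g f : Lor) (z : Sphere) :
    confFactor (g * f) z = confFactor g (lorAct f z) * confFactor f z := by
  induction g using QuotientGroup.induction_on with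
  | H B =>
  induction f using QuotientGroup.induction_on with
  | H A =>
  change slFactor (B * A) (kappa z) = slFactor B (kappa (slAct A z)) * slFactor A (kappa z)
  have hz := homCoord_ne (kappa z)
  have hne := mul_homCoord_ne A hz
  have key : slFactor B (kappa (slAct A z))
      = ((Complex.normSq (B 0 0 * (A 0 0 * (homCoord (kappa z)).1 + A 0 1 * (homCoord (kappa z)).2)
          + B 0 1 * (A 1 0 * (homCoord (kappa z)).1 + A 1 1 * (homCoord (kappa z)).2))
        + Complex.normSq (B 1 0 * (A 0 0 * (homCoord (kappa z)).1 + A 0 1 * (homCoord (kappa z)).2)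
          + B 1 1 * (A 1 0 * (homCoord (kappa z)).1 + A 1 1 * (homCoord (kappa z)).2)))
        / (Complex.normSq (A 0 0 * (homCoord (kappa z)).1 + A 0 1 * (homCoord (kappa z)).2)
          + Complex.normSq (A 1 0 * (homCoord (kappa z)).1 + A 1 1 * (homCoord (kappa z)).2)))⁻¹ := by
    rw [← inv_inv (slFactor B _), inv_slFactor, slAct_val, hermPoly_hopf _ _ hne,
      hermPoly_hopf _ _ hne, ← add_div]
  have hent : ∀ i j, (B * A) i j = B i 0 * A 0 j + B i 1 * A 1 j := by
    intro i j
    rw [Matrix.SpecialLinearGroup.coe_mul, Matrix.mul_apply, Fin.sum_univ_two]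
  have e : ∀ i, (B * A) i 0 * (homCoord (kappa z)).1 + (B * A) i 1 * (homCoord (kappa z)).2
      = B i 0 * (A 0 0 * (homCoord (kappa z)).1 + A 0 1 * (homCoord (kappa z)).2)
          + B i 1 * (A 1 0 * (homCoord (kappa z)).1 + A 1 1 * (homCoord (kappa z)).2) := by
    intro i
    rw [hent, hent]
    ring
  rw [key, slFactor_eq (B * A), slFactor_eq A, e 0, e 1, inv_div, mul_comm (_ / _),
    div_mul_div_cancel₀ (normSq_add_pos hne).ne']

/-! ### Supertranslations and the action of the Lorentz group -/

/-- The space `C^∞(S²)` of supertranslations. -/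
abbrev Supertranslation : Type :=
  ContMDiffMap (𝓡 2) 𝓘(ℝ, ℝ) Sphere ℝ ∞

/-- The compact-open `C^∞` topology: uniform convergence on compact sets of all derivatives in all
stereographic charts of the sphere. -/
instance : TopologicalSpace Supertranslation :=
  ⨅ (v : Sphere) (k : ℕ), TopologicalSpace.induced
    (fun α : Supertranslation => UniformOnFun.ofFun {C | IsCompact C}
      (iteratedFDeriv ℝ k
        (fun x => α ((chartAt (EuclideanSpace ℝ (Fin 2)) v).symm x)))) inferInstance

/-- The right action `σ(α, f) = K_f⁻¹ · (α ∘ f)` of the Lorentz group on supertranslations. -/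
def sigma (α : Supertranslation) (f : Lor) : Supertranslation :=
  ⟨fun z => (confFactor f z)⁻¹ * α (lorAct f z),
    (contMDiff_inv_confFactor f).mul (α.contMDiff.comp (contMDiff_lorAct f))⟩

theorem sigma_apply (α : Supertranslation) (f : Lor) (z : Sphere) :
    sigma α f z = (confFactor f z)⁻¹ * α (lorAct f z) := rfl

theorem sigma_one (α : Supertranslation) : sigma α 1 = α := by
  ext z
  rw [sigma_apply, confFactor_one, map_one]
  simp

theorem sigma_sigma (α : Supertranslation) (g f : Lor) :
    sigma (sigma α g) f = sigma α (g * f) := by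
  ext z
  simp only [sigma_apply]
  rw [confFactor_mul, map_mul, mul_inv, Equiv.Perm.mul_apply]
  ring

theorem sigma_add (α β : Supertranslation) (f : Lor) :
    sigma (α + β) f = sigma α f + sigma β f := by
  ext z
  simp only [sigma_apply, ContMDiffMap.coe_add, Pi.add_apply]
  ring

/-! ### The analytic structure of the Lorentz group -/

/-- Near the identity, a Möbius transformation is represented by a unique matrix in `SL(2, ℂ)` with
upper left entry of positive real part, whose entries `a, b, c` are the coordinates. -/
def lorChartFun (f : Lor) : ℂ × ℂ × ℂ :=
  Quotient.liftOn' f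
    (fun A => ((SignType.sign (A 0 0).re : SignType) : ℝ) • ((A 0 0, A 0 1, A 1 0) : ℂ × ℂ × ℂ)) (by
    intro A B h
    rcases eq_or_eq_neg_of_inv_mul_mem (QuotientGroup.leftRel_apply.1 h) with rfl | rfl
    · rfl
    · simp [Left.sign_neg])

/-- The matrix in `SL(2, ℂ)` with the entries `a ≠ 0`, `b`, `c`. -/
def slOfEntries (a b c : ℂ) (h : a ≠ 0) : SL(2, ℂ) :=
  ⟨!![a, b; c, (1 + b * c) / a], by
    rw [Matrix.det_fin_two_of, mul_div_cancel₀ _ h]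
    ring⟩

/-- The inverse of the chart. -/
def lorChartInv (p : ℂ × ℂ × ℂ) : Lor :=
  if h : p.1 ≠ 0 then QuotientGroup.mk (slOfEntries p.1 p.2.1 p.2.2 h) else 1

theorem lorChartFun_mk (A : SL(2, ℂ)) : lorChartFun (QuotientGroup.mk A)
    = ((SignType.sign (A 0 0).re : SignType) : ℝ) • ((A 0 0, A 0 1, A 1 0) : ℂ × ℂ × ℂ) := rfl

theorem mk_neg (A : SL(2, ℂ)) : (QuotientGroup.mk (-A) : Lor) = QuotientGroup.mk A := by
  rw [eq_comm, QuotientGroup.eq, Matrix.SpecialLinearGroup.mem_center_iff]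
  refine ⟨-1, by simp, ?_⟩
  have : A⁻¹ * -A = -1 := by rw [mul_neg, inv_mul_cancel]
  rw [this, map_neg, map_one]
  rfl

theorem exists_rep {f : Lor} (h : 0 < (lorChartFun f).1.re) :
    ∃ A : SL(2, ℂ), QuotientGroup.mk A = f ∧ 0 < (A 0 0).re := by
  induction f using QuotientGroup.induction_on with
  | H A =>
  rw [lorChartFun_mk] at h
  rcases lt_trichotomy (A 0 0).re 0 with h' | h' | h'
  · exact ⟨-A, mk_neg A, by simpa using h'⟩
  · simp [h'] at h
  · exact ⟨A, rfl, h'⟩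

theorem lorChartFun_mk_of_pos {A : SL(2, ℂ)} (h : 0 < (A 0 0).re) :
    lorChartFun (QuotientGroup.mk A) = (A 0 0, A 0 1, A 1 0) := by
  rw [lorChartFun_mk, sign_pos h]
  simp

theorem lorChartInv_of_ne {p : ℂ × ℂ × ℂ} (h : p.1 ≠ 0) :
    lorChartInv p = QuotientGroup.mk (slOfEntries p.1 p.2.1 p.2.2 h) := dif_pos h

theorem continuous_entry (i j : Fin 2) : Continuous (fun A : SL(2, ℂ) => A i j) :=
  (continuous_subtype_val (p := fun A : Matrix (Fin 2) (Fin 2) ℂ => A.det = 1)).matrix_elem i j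

theorem isOpen_chart_source : IsOpen {f : Lor | 0 < (lorChartFun f).1.re} := by
  have hq : IsOpenMap (QuotientGroup.mk : SL(2, ℂ) → Lor) := QuotientGroup.isOpenMap_coe
  have e : {f : Lor | 0 < (lorChartFun f).1.re}
      = QuotientGroup.mk '' {A : SL(2, ℂ) | 0 < (A 0 0).re} := by
    ext f
    constructor
    · intro h
      obtain ⟨A, rfl, hA⟩ := exists_rep h
      exact ⟨A, hA, rfl⟩
    · rintro ⟨A, hA, rfl⟩
      change 0 < (lorChartFun (QuotientGroup.mk A)).1.re
      rw [lorChartFun_mk_of_pos hA]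
      exact hA
  rw [e]
  exact hq _ (isOpen_lt continuous_const (Complex.continuous_re.comp (continuous_entry 0 0)))

/-- The chart of the Lorentz group around the identity. -/
def lorChart : OpenPartialHomeomorph Lor (ℂ × ℂ × ℂ) where
  toFun := lorChartFun
  invFun := lorChartInv
  source := {f | 0 < (lorChartFun f).1.re}
  target := {p | 0 < p.1.re}
  map_source' _ h := h
  map_target' p h := by
    have h0 : p.1 ≠ 0 := by rintro h0; simp [h0] at h
    change 0 < (lorChartFun (lorChartInv p)).1.re
    rw [lorChartInv_of_ne h0, lorChartFun_mk_of_pos (by exact h)]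
    exact h
  left_inv' f h := by
    obtain ⟨A, rfl, hA⟩ := exists_rep h
    have h0 : A 0 0 ≠ 0 := by intro h0; simp [h0] at hA
    rw [lorChartFun_mk_of_pos hA, lorChartInv_of_ne h0]
    congr 1
    have hd := A.2
    rw [Matrix.det_fin_two] at hd
    apply Subtype.ext
    ext i j
    fin_cases i <;> fin_cases j
    · rfl
    · rfl
    · rfl
    · change (1 + A 0 1 * A 1 0) / A 0 0 = A 1 1
      rw [div_eq_iff h0]
      linear_combination -hd
  right_inv' p h := by
    have h0 : p.1 ≠ 0 := by rintro h0; simp [h0] at h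
    rw [lorChartInv_of_ne h0, lorChartFun_mk_of_pos (by exact h)]
    rfl
  open_source := isOpen_chart_source
  open_target := isOpen_lt continuous_const (Complex.continuous_re.comp continuous_fst)
  continuousOn_toFun := by
    intro f h
    apply ContinuousAt.continuousWithinAt
    obtain ⟨A, rfl, hA⟩ := exists_rep h
    have hq : IsOpenMap (QuotientGroup.mk : SL(2, ℂ) → Lor) := QuotientGroup.isOpenMap_coe
    have hev : ∀ᶠ B : SL(2, ℂ) in 𝓝 A, 0 < (B 0 0).re :=
      (isOpen_lt continuous_const
        (Complex.continuous_re.comp (continuous_entry 0 0))).mem_nhds hA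
    have hc : ContinuousAt (fun B : SL(2, ℂ) => ((B 0 0, B 0 1, B 1 0) : ℂ × ℂ × ℂ)) A :=
      ((continuous_entry 0 0).prodMk
        ((continuous_entry 0 1).prodMk (continuous_entry 1 0))).continuousAt
    have hc' : ContinuousAt (fun B : SL(2, ℂ) => lorChartFun (QuotientGroup.mk B)) A :=
      hc.congr (hev.mono fun B hB => (lorChartFun_mk_of_pos hB).symm)
    have : Tendsto (lorChartFun ∘ (QuotientGroup.mk : SL(2, ℂ) → Lor)) (𝓝 A)
        (𝓝 (lorChartFun (QuotientGroup.mk A))) := hc'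
    rw [← tendsto_map'_iff] at this
    exact this.mono_left (hq.nhds_le A)
  continuousOn_invFun := by
    rw [continuousOn_iff_continuous_domRestrict]
    have h0 : ∀ p : {p : ℂ × ℂ × ℂ | 0 < p.1.re}, p.1.1 ≠ 0 := by
      rintro ⟨p, hp⟩ h0
      simp only at h0
      simp [h0] at hp
    have e : Set.domRestrict {p : ℂ × ℂ × ℂ | 0 < p.1.re} lorChartInv
        = fun p => (QuotientGroup.mk (slOfEntries p.1.1 p.1.2.1 p.1.2.2 (h0 p)) : Lor) :=
      funext fun p => lorChartInv_of_ne (h0 p)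
    rw [e]
    refine continuous_quotient_mk'.comp (Continuous.subtype_mk ?_ _)
    refine continuous_matrix fun i j => ?_
    fin_cases i <;> fin_cases j
    · exact continuous_subtype_val.fst
    · exact continuous_subtype_val.snd.fst
    · exact continuous_subtype_val.snd.snd
    · exact (continuous_const.add (continuous_subtype_val.snd.fst.mul
        continuous_subtype_val.snd.snd)).div continuous_subtype_val.fst h0

/-- The real analytic atlas of the Lorentz group: the translates of the chart around the
identity. -/
def lorAtlas : Set (OpenPartialHomeomorph Lor (ℂ × ℂ × ℂ)) :=
  Set.range fun g : Lor => (Homeomorph.mulLeft g).transOpenPartialHomeomorph lorChart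

/-! ### The BMS group -/

/-- The BMS group, the semidirect product of the supertranslations with the Lorentz group. -/
def BMSGroup : Type := Supertranslation × Lor

instance : TopologicalSpace BMSGroup := inferInstanceAs (TopologicalSpace (Supertranslation × Lor))

/-- The product `(F, φ) (G, ψ) = (F + σ(G, φ), ψ ∘ φ)`. As `σ` is a right action, Lorentz
transformations are composed from left to right. -/
instance : Mul BMSGroup := ⟨fun x y => (x.1 + sigma y.1 x.2, y.2 * x.2)⟩

instance : One BMSGroup := ⟨((0 : Supertranslation), (1 : Lor))⟩

/-- The inverse `(F, ψ)⁻¹ = (-σ(F, ψ⁻¹), ψ⁻¹)`. -/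
instance : Inv BMSGroup := ⟨fun x => (-sigma x.1 x.2⁻¹, x.2⁻¹)⟩

instance : Group BMSGroup :=
  Group.ofLeftAxioms
    (fun x y z => Prod.ext
      (by
        change (x.1 + sigma y.1 x.2) + sigma z.1 (y.2 * x.2)
          = x.1 + sigma (y.1 + sigma z.1 y.2) x.2
        rw [sigma_add, sigma_sigma, add_assoc])
      (by
        change z.2 * (y.2 * x.2) = (z.2 * y.2) * x.2
        rw [mul_assoc]))
    (fun x => Prod.ext
      (by
        change (0 : Supertranslation) + sigma x.1 1 = x.1
        rw [sigma_one, zero_add])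
      (by
        change x.2 * 1 = x.2
        rw [mul_one]))
    (fun x => Prod.ext
      (by
        change -sigma x.1 x.2⁻¹ + sigma x.1 x.2⁻¹ = 0
        rw [neg_add_cancel])
      (by
        change x.2 * x.2⁻¹ = 1
        rw [mul_inv_cancel]))

/-- The model space of the BMS group. -/
abbrev BMSModel : Type := Supertranslation × (ℂ × ℂ × ℂ)

/-- The product atlas of the BMS group, which defines its structure of a Fréchet manifold. -/
def bmsAtlas : Set (OpenPartialHomeomorph BMSGroup BMSModel) :=
  prodAtlas (modelAtlas Supertranslation) lorAtlas

end BMS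

end

/-! The obstruction is a supertranslation that is smooth but not analytic. Let `hemisphereBump` be
exp(-1/x) in the first coordinate x of the sphere where x > 0, and 0 elsewhere. The north pole N
lies on the boundary of its support. The Möbius transformations f_t with matrix (1, 0; t, 1) move N
to a point with x = 2t/(1+t²), so σ(α, f_t)(N) vanishes for t ≤ 0 and not for t > 0. By the identity
theorem this is not the germ of an analytic function of t (`not_analyticAt_of_sigma`).

A real analytic map has a holomorphic extension, hence is analytic along straight lines of a chart
after evaluation at N. This refutes analyticity of σ, and, because (0, f_t)(α, 1) = (σ(α, f_t),
f_t), also that of the multiplication for the product structure.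

For an arbitrary compatible analytic structure, the change τ from its chart e at the identity to the
standard chart is only smooth, so neither t ↦ f_t nor evaluation at N need be analytic in e. Both
defects are avoided by differentiating conjugation. Conjugation by G maps (F, 1) to (σ(F, G.2), 1)
and fixes the identity. Its derivative at the identity in a fixed direction w depends analytically
on G, and τ enters only through its derivative at the one point e(1), a fixed continuous linear
functional after evaluation at N (`exists_analyticAt_deriv_conj`). With w tangent to s ↦ (sα, 1),
this gives an analytic function of t equal to σ(α, φ_t)(N), where φ_t is the Lorentz part of a
straight line in e. That line is chosen tangent to t ↦ f_t. Crossing the boundary of the hemisphere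
with nonzero speed is a first-order condition, so the contradiction persists.

The model spaces are not normed, so the calculus rests on `HasDirDerivOn.tendsto_quotient`, a mean
value estimate for scalar functions. It gives a chain rule whenever the outer function is scalar,
and every vector-valued map is first composed with a linear functional or a smooth scalar
coordinate. -/

namespace BMS

/-! ### Maps with continuous directional derivatives -/

section DirDeriv

variable {𝕜 : Type*} [RCLike 𝕜]
  {E : Type*} [AddCommGroup E] [Module 𝕜 E] [TopologicalSpace E]
  {F : Type*} [AddCommGroup F] [Module 𝕜 F] [TopologicalSpace F]
  {G : Type*} [AddCommGroup G] [Module 𝕜 G] [TopologicalSpace G]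

/-- `f` is continuously differentiable on the open set `U` in the sense of Bastiani, with the
directional derivatives `d x y = (D_y f)(x)`. -/
structure HasDirDerivOn (𝕜 : Type*) [RCLike 𝕜] {E F : Type*}
    [AddCommGroup E] [Module 𝕜 E] [TopologicalSpace E]
    [AddCommGroup F] [Module 𝕜 F] [TopologicalSpace F]
    (f : E → F) (d : E → E → F) (U : Set E) : Prop where
  isOpen : IsOpen U
  continuousOn : ContinuousOn f U
  tendsto : ∀ x ∈ U, ∀ y,
    Tendsto (fun t : 𝕜 => t⁻¹ • (f (x + t • y) - f x)) (𝓝[≠] 0) (𝓝 (d x y))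
  continuousOn_deriv : ContinuousOn (fun p : E × E => d p.1 p.2) (U ×ˢ univ)

theorem tendsto_add_smul [IsTopologicalAddGroup E] [ContinuousSMul 𝕜 E] (x y : E) :
    Tendsto (fun t : 𝕜 => x + t • y) (𝓝 0) (𝓝 x) := by
  have h : Continuous (fun t : 𝕜 => x + t • y) := by fun_prop
  simpa using h.tendsto 0

/-- Only the orders 0 and 1 of the iterated derivatives are used in what follows; order 0 supplies
the continuity of `f` itself. -/
theorem SmoothOn.exists_hasDirDerivOn [IsTopologicalAddGroup E] [ContinuousSMul 𝕜 E]
    {f : E → F} {U : Set E} (h : SmoothOn 𝕜 f U) : ∃ d, HasDirDerivOn 𝕜 f d U := by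
  obtain ⟨hU, d, h0, h1, hc⟩ := h
  refine ⟨fun x y => d 1 x fun _ => y, hU, ?_, ?_, ?_⟩
  · refine ((hc 0).comp (f := fun x : E => (x, fun _ => (0 : E))) (by fun_prop)
      (fun x hx => ⟨hx, mem_univ _⟩)).congr fun x hx => ?_
    exact (h0 x hx _).symm
  · intro x hx y
    refine (h1 0 x hx fun _ => y).congr' ?_
    have hev : ∀ᶠ t : 𝕜 in 𝓝[≠] 0, x + t • y ∈ U :=
      nhdsWithin_le_nhds ((tendsto_add_smul x y).eventually (hU.mem_nhds hx))
    filter_upwards [hev] with t ht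
    rw [h0 _ hx, h0 _ ht]
  · exact (hc 1).comp (f := fun p : E × E => (p.1, fun _ => p.2)) (by fun_prop)
      (fun p hp => ⟨hp.1, mem_univ _⟩)

theorem HasDirDerivOn.mono {f : E → F} {d : E → E → F} {U V : Set E}
    (h : HasDirDerivOn 𝕜 f d U) (hV : IsOpen V) (hVU : V ⊆ U) : HasDirDerivOn 𝕜 f d V :=
  ⟨hV, h.continuousOn.mono hVU, fun x hx => h.tendsto x (hVU hx),
    h.continuousOn_deriv.mono (prod_mono hVU subset_rfl)⟩

theorem HasDirDerivOn.congr [IsTopologicalAddGroup E] [ContinuousSMul 𝕜 E]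
    {f g : E → F} {d : E → E → F} {U : Set E}
    (h : HasDirDerivOn 𝕜 f d U) (hfg : EqOn g f U) : HasDirDerivOn 𝕜 g d U := by
  refine ⟨h.isOpen, h.continuousOn.congr hfg, fun x hx y => ?_, h.continuousOn_deriv⟩
  refine (h.tendsto x hx y).congr' ?_
  have hev : ∀ᶠ t : 𝕜 in 𝓝[≠] 0, x + t • y ∈ U :=
    nhdsWithin_le_nhds ((tendsto_add_smul x y).eventually (h.isOpen.mem_nhds hx))
  filter_upwards [hev] with t ht
  rw [hfg hx, hfg ht]

theorem HasDirDerivOn.clm_comp (L : F →L[𝕜] G) {f : E → F} {d : E → E → F} {U : Set E}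
    (h : HasDirDerivOn 𝕜 f d U) :
    HasDirDerivOn 𝕜 (fun x => L (f x)) (fun x y => L (d x y)) U := by
  refine ⟨h.isOpen, L.continuous.comp_continuousOn h.continuousOn, fun x hx y => ?_,
    L.continuous.comp_continuousOn h.continuousOn_deriv⟩
  refine ((L.continuous.tendsto _).comp (h.tendsto x hx y)).congr fun t => ?_
  simp

/-- Composition with a continuous affine map from the right. -/
theorem HasDirDerivOn.comp_affine (a : F) (L : E →L[𝕜] F) [ContinuousAdd F]
    {f : F → G} {d : F → F → G} {U : Set F} (h : HasDirDerivOn 𝕜 f d U) :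
    HasDirDerivOn 𝕜 (fun x => f (a + L x)) (fun x y => d (a + L x) (L y))
      ((fun x => a + L x) ⁻¹' U) := by
  have hc : Continuous fun x => a + L x := continuous_const.add L.continuous
  refine ⟨h.isOpen.preimage hc, h.continuousOn.comp hc.continuousOn fun x hx => hx,
    fun x hx y => ?_, h.continuousOn_deriv.comp (f := fun p : E × E => (a + L p.1, L p.2))
      ((hc.comp continuous_fst).prodMk (L.continuous.comp continuous_snd)).continuousOn
      fun p hp => ⟨hp.1, mem_univ _⟩⟩
  refine (h.tendsto _ hx (L y)).congr fun t => ?_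
  simp [add_assoc]

theorem HasDirDerivOn.comp_clm (L : E →L[𝕜] F) [ContinuousAdd F]
    {f : F → G} {d : F → F → G} {U : Set F} (h : HasDirDerivOn 𝕜 f d U) :
    HasDirDerivOn 𝕜 (fun x => f (L x)) (fun x y => d (L x) (L y)) (L ⁻¹' U) := by
  simpa using h.comp_affine 0 L

theorem HasDirDerivOn.prodMk {f : E → F} {d : E → E → F} {g : E → G} {d' : E → E → G} {U : Set E}
    (hf : HasDirDerivOn 𝕜 f d U) (hg : HasDirDerivOn 𝕜 g d' U) :
    HasDirDerivOn 𝕜 (fun x => (f x, g x)) (fun x y => (d x y, d' x y)) U :=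
  ⟨hf.isOpen, hf.continuousOn.prodMk hg.continuousOn,
    fun x hx y => (hf.tendsto x hx y).prodMk_nhds (hg.tendsto x hx y),
    hf.continuousOn_deriv.prodMk hg.continuousOn_deriv⟩

/-- The difference quotients of a scalar function converge to the directional derivative even if
the base point and the direction vary. -/
theorem HasDirDerivOn.tendsto_quotient [IsTopologicalAddGroup E] [ContinuousSMul 𝕜 E]
    {f : E → 𝕜} {d : E → E → 𝕜} {U : Set E} (h : HasDirDerivOn 𝕜 f d U)
    {ι : Type*} {l : Filter ι} {p q : ι → E} {t : ι → 𝕜} {p₀ q₀ : E} (hp₀ : p₀ ∈ U)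
    (hp : Tendsto p l (𝓝 p₀)) (hq : Tendsto q l (𝓝 q₀)) (ht : Tendsto t l (𝓝[≠] 0)) :
    Tendsto (fun i => (t i)⁻¹ * (f (p i + t i • q i) - f (p i))) l (𝓝 (d p₀ q₀)) := by
  rw [Metric.tendsto_nhds]
  intro ε hε
  have hmem : ∀ᶠ x : E × E × 𝕜 in 𝓝 (p₀, q₀, 0), x.1 + x.2.2 • x.2.1 ∈ U ∧
      ‖d (x.1 + x.2.2 • x.2.1) x.2.1 - d p₀ q₀‖ ≤ ε / 2 := by
    have hc : Tendsto (fun x : E × E × 𝕜 => (x.1 + x.2.2 • x.2.1, x.2.1)) (𝓝 (p₀, q₀, 0))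
        (𝓝 (p₀, q₀)) := by
      have : Continuous fun x : E × E × 𝕜 => (x.1 + x.2.2 • x.2.1, x.2.1) := by fun_prop
      simpa using this.tendsto (p₀, q₀, 0)
    have hU : U ×ˢ (univ : Set E) ∈ 𝓝 (p₀, q₀) :=
      prod_mem_nhds (h.isOpen.mem_nhds hp₀) univ_mem
    have hd : Tendsto (fun p : E × E => d p.1 p.2) (𝓝 (p₀, q₀)) (𝓝 (d p₀ q₀)) :=
      h.continuousOn_deriv.continuousAt hU
    refine ((hc.eventually hU).mono fun x hx => hx.1).and ?_
    have := (Metric.tendsto_nhds.1 (hd.comp hc)) (ε / 2) (half_pos hε)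
    filter_upwards [this] with x hx
    rw [← dist_eq_norm]
    exact hx.le
  have hmem' : ∀ᶠ x : (E × E) × 𝕜 in 𝓝 (p₀, q₀) ×ˢ 𝓝 0, x.1.1 + x.2 • x.1.2 ∈ U ∧
      ‖d (x.1.1 + x.2 • x.1.2) x.1.2 - d p₀ q₀‖ ≤ ε / 2 := by
    have hc : Continuous fun x : (E × E) × 𝕜 => (x.1.1, x.1.2, x.2) := by fun_prop
    rw [← nhds_prod_eq]
    exact (hc.tendsto ((p₀, q₀), 0)).eventually hmem
  rw [eventually_prod_iff] at hmem'
  obtain ⟨A, hA, B, hB, hAB⟩ := hmem'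
  obtain ⟨δ, hδ, hBδ⟩ := Metric.eventually_nhds_iff_ball.1 hB
  have ht' := tendsto_nhdsWithin_iff.1 ht
  filter_upwards [(hp.prodMk_nhds hq).eventually hA, ht'.1.eventually (Metric.ball_mem_nhds 0 hδ), ht'.2]
    with i hi hti hne
  -- On the line through `p i` in the direction `q i`, subtracting `u * d p₀ q₀` leaves a function
  -- whose derivative is at most `ε / 2` in norm, and the mean value inequality between `0` and `t
  -- i` applies.
  have hderiv : ∀ u ∈ Metric.ball (0 : 𝕜) δ,
      HasDerivWithinAt (fun u => f (p i + u • q i) - u * d p₀ q₀)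
        (d (p i + u • q i) (q i) - d p₀ q₀) (Metric.ball (0 : 𝕜) δ) u := by
    intro u hu
    refine (HasDerivAt.sub ?_ ?_).hasDerivWithinAt
    · rw [hasDerivAt_iff_tendsto_slope_zero]
      refine (h.tendsto _ (hAB hi (hBδ u hu)).1 (q i)).congr fun t => ?_
      simp [add_smul, add_assoc]
    · simpa using (hasDerivAt_id u).mul_const (d p₀ q₀)
  have hb := Convex.norm_image_sub_le_of_norm_hasDerivWithin_le hderiv
    (fun u hu => (hAB hi (hBδ u hu)).2) (convex_ball 0 δ) (Metric.mem_ball_self hδ) hti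
  have hpos : 0 < ‖t i‖ := norm_pos_iff.2 hne
  rw [dist_eq_norm]
  have e : (t i)⁻¹ * (f (p i + t i • q i) - f (p i)) - d p₀ q₀
      = (t i)⁻¹ * ((f (p i + t i • q i) - t i * d p₀ q₀)
        - (f (p i + (0 : 𝕜) • q i) - 0 * d p₀ q₀)) := by
    rw [zero_smul, add_zero]
    have : t i ≠ 0 := hne
    field_simp
    ring
  rw [e, norm_mul, norm_inv]
  calc ‖t i‖⁻¹ * _ ≤ ‖t i‖⁻¹ * (ε / 2 * ‖t i - 0‖) := by gcongr
    _ = ε / 2 := by rw [sub_zero]; field_simp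
    _ < ε := half_lt_self hε

/-- The chain rule for a scalar function of a continuously differentiable map. -/
theorem HasDirDerivOn.comp [IsTopologicalAddGroup F] [ContinuousSMul 𝕜 F]
    [IsTopologicalAddGroup E] [ContinuousSMul 𝕜 E]
    {g : F → 𝕜} {dg : F → F → 𝕜} {V : Set F} (hg : HasDirDerivOn 𝕜 g dg V)
    {f : E → F} {df : E → E → F} {U : Set E} (hf : HasDirDerivOn 𝕜 f df U) :
    HasDirDerivOn 𝕜 (fun x => g (f x)) (fun x y => dg (f x) (df x y)) (U ∩ f ⁻¹' V) := by
  refine ⟨hf.continuousOn.isOpen_inter_preimage hf.isOpen hg.isOpen,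
    hg.continuousOn.comp (hf.continuousOn.mono inter_subset_left) fun x hx => hx.2,
    fun x hx y => ?_, ?_⟩
  -- For `t ≠ 0` one has `f (x + t • y) = f x + t • q t`, with `q t` the difference quotient of `f`.
  -- The base point `f x` is fixed and only the direction `q t` varies, with limit `df x y`.
  · have := hg.tendsto_quotient (l := 𝓝[≠] (0 : 𝕜)) hx.2 (tendsto_const_nhds (x := f x))
      (hf.tendsto x hx.1 y) tendsto_id
    refine this.congr' ?_
    filter_upwards [self_mem_nhdsWithin] with t ht
    have ht' : t ≠ 0 := ht
    simp [smul_smul, ht']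
  · refine hg.continuousOn_deriv.comp (f := fun p : E × E => (f p.1, df p.1 p.2)) ?_
      fun p hp => ⟨hp.1.2, mem_univ _⟩
    exact (hf.continuousOn.comp continuousOn_fst fun p hp => hp.1.1).prodMk
      (hf.continuousOn_deriv.mono (prod_mono inter_subset_left subset_rfl))

/-- The increment along `t • (y + z)` splits into the increments from `x` to `x + t • y` and from
there along `t • z`. The second has a moving base point, which `tendsto_quotient` allows. -/
theorem HasDirDerivOn.map_add [IsTopologicalAddGroup E] [ContinuousSMul 𝕜 E]
    {f : E → 𝕜} {d : E → E → 𝕜} {U : Set E} (h : HasDirDerivOn 𝕜 f d U) {x : E} (hx : x ∈ U)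
    (y z : E) : d x (y + z) = d x y + d x z := by
  refine tendsto_nhds_unique (h.tendsto x hx (y + z)) ?_
  have h1 := h.tendsto x hx y
  have h2 := h.tendsto_quotient (l := 𝓝[≠] (0 : 𝕜)) (p := fun t => x + t • y) (q := fun _ => z)
    hx ((tendsto_add_smul x y).mono_left nhdsWithin_le_nhds) tendsto_const_nhds tendsto_id
  refine (h1.add h2).congr fun t => ?_
  simp only [id, smul_eq_mul, smul_add, add_assoc]
  ring

/-- The derivative of a real function at a point, as a continuous linear functional. -/
theorem HasDirDerivOn.exists_clm {E : Type*} [AddCommGroup E] [Module ℝ E] [TopologicalSpace E]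
    [IsTopologicalAddGroup E] [ContinuousSMul ℝ E]
    {f : E → ℝ} {d : E → E → ℝ} {U : Set E} (h : HasDirDerivOn ℝ f d U) {x : E} (hx : x ∈ U) :
    ∃ L : E →L[ℝ] ℝ, ∀ y, L y = d x y := by
  have hc : Continuous (d x) := by
    rw [← continuousOn_univ]
    exact h.continuousOn_deriv.comp (f := fun y => (x, y)) (by fun_prop) fun y _ => ⟨hx, mem_univ _⟩
  -- A continuous additive map is linear over the reals, so homogeneity needs no separate argument.
  exact ⟨(AddMonoidHom.mk' (d x) (h.map_add hx)).toRealLinearMap hc, fun y => rfl⟩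

end DirDeriv

/-! ### Holomorphic functions along complex lines -/

section Holomorphic

variable {E : Type*} [AddCommGroup E] [Module ℂ E] [TopologicalSpace E]
  {f : E → ℂ} {d : E → E → ℂ} {U : Set E}

theorem HasDirDerivOn.differentiableAt_line (h : HasDirDerivOn ℂ f d U) {a : E} (b : E) {ζ : ℂ}
    (hζ : a + ζ • b ∈ U) : DifferentiableAt ℂ (fun ζ : ℂ => f (a + ζ • b)) ζ := by
  refine HasDerivAt.differentiableAt (f' := d (a + ζ • b) b) ?_
  rw [hasDerivAt_iff_tendsto_slope_zero]
  refine (h.tendsto _ hζ b).congr fun t => ?_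
  simp [add_smul, add_assoc]

variable [IsTopologicalAddGroup E] [ContinuousSMul ℂ E]

/-- A holomorphic function is analytic along complex lines. -/
theorem HasDirDerivOn.analyticAt_line (h : HasDirDerivOn ℂ f d U) {a : E} (ha : a ∈ U) (b : E) :
    AnalyticAt ℂ (fun ζ : ℂ => f (a + ζ • b)) 0 := by
  rw [Complex.analyticAt_iff_eventually_differentiableAt]
  filter_upwards [(tendsto_add_smul a b).eventually (h.isOpen.mem_nhds ha)] with ζ hζ
  exact h.differentiableAt_line b hζ

/-- The directional derivatives of a holomorphic function are analytic along complex lines. -/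
theorem HasDirDerivOn.analyticAt_deriv_line (h : HasDirDerivOn ℂ f d U) {a : E} (ha : a ∈ U)
    (b c : E) : AnalyticAt ℂ (fun ζ : ℂ => d (a + ζ • b) c) 0 := by
  have hc : Continuous fun x : ℂ × ℂ => (a + x.1 • b) + x.2 • c := by fun_prop
  have hev : ∀ᶠ x : ℂ × ℂ in 𝓝 (0, 0), (a + x.1 • b) + x.2 • c ∈ U :=
    (hc.tendsto (0, 0)).eventually (h.isOpen.mem_nhds (by simpa using ha))
  rw [nhds_prod_eq, eventually_prod_iff] at hev
  obtain ⟨A, hA, B, hB, hAB⟩ := hev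
  obtain ⟨W, hWA, hWo, h0W⟩ := eventually_nhds_iff.1 hA
  have hmem : ∀ ζ ∈ W, a + ζ • b ∈ U := fun ζ hζ => by
    simpa using hAB (hWA ζ hζ) hB.self_of_nhds
  -- By Weierstrass, a locally uniform limit of holomorphic functions is holomorphic. The difference
  -- quotients in `t` are holomorphic in `ζ`. Their convergence is locally uniform because the
  -- quotient and `d (a + ζ • b) c` tend to the same value jointly in `(t, ζ)`.
  have hunif : TendstoLocallyUniformlyOn
      (fun (t : ℂ) (ζ : ℂ) => t⁻¹ * (f (a + ζ • b + t • c) - f (a + ζ • b)))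
      (fun ζ => d (a + ζ • b) c) (𝓝[≠] 0) W := by
    rw [tendstoLocallyUniformlyOn_iff_filter]
    intro ζ hζ
    rw [tendstoUniformlyOnFilter_iff_tendsto]
    have hline : Tendsto (fun q : ℂ × ℂ => a + q.2 • b) (𝓝[≠] 0 ×ˢ 𝓝[W] ζ) (𝓝 (a + ζ • b)) := by
      have h1 : Continuous fun ζ : ℂ => a + ζ • b := by fun_prop
      exact (h1.tendsto ζ).comp (tendsto_snd.mono_right nhdsWithin_le_nhds)
    have h1 := h.tendsto_quotient (q := fun _ : ℂ × ℂ => c) (hmem ζ hζ) hline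
      tendsto_const_nhds tendsto_fst
    have hd : Tendsto (fun q : ℂ × ℂ => d (a + q.2 • b) c) (𝓝[≠] 0 ×ˢ 𝓝[W] ζ)
        (𝓝 (d (a + ζ • b) c)) := by
      have := h.continuousOn_deriv.continuousAt
        (prod_mem_nhds (h.isOpen.mem_nhds (hmem ζ hζ)) (univ_mem : univ ∈ 𝓝 c))
      exact this.tendsto.comp (hline.prodMk_nhds tendsto_const_nhds)
    exact (hd.prodMk_nhds h1).mono_right (nhds_le_uniformity _)
  have hdiff : DifferentiableOn ℂ (fun ζ : ℂ => d (a + ζ • b) c) W := by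
    refine hunif.differentiableOn ?_ hWo
    filter_upwards [nhdsWithin_le_nhds hB] with t ht ζ hζ
    refine (((h.differentiableAt_line (a := a + t • c) b (ζ := ζ) ?_).congr_of_eventuallyEq
      (Eventually.of_forall fun ζ => ?_)).sub
      (h.differentiableAt_line b (hmem ζ hζ))).const_mul _ |>.differentiableWithinAt
    · rw [add_right_comm]
      exact hAB (hWA ζ hζ) ht
    · simp only [add_right_comm]
  exact hdiff.analyticAt (hWo.mem_nhds h0W)

/-- An analytic function which vanishes on the left of `0` vanishes on the right of `0`. -/
theorem not_analyticAt_of_one_sided {h : ℂ → ℂ} (hneg : ∀ᶠ t : ℝ in 𝓝[<] 0, h t = 0)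
    (hpos : ∀ᶠ t : ℝ in 𝓝[>] 0, h t ≠ 0) : ¬ AnalyticAt ℂ h 0 := by
  intro ha
  have hc : Tendsto (fun t : ℝ => (t : ℂ)) (𝓝 0) (𝓝 0) := by
    simpa using Complex.continuous_ofReal.tendsto 0
  have hfr : ∃ᶠ z in 𝓝[≠] (0 : ℂ), h z = 0 := by
    have : Tendsto (fun t : ℝ => (t : ℂ)) (𝓝[<] 0) (𝓝[≠] 0) := by
      refine tendsto_nhdsWithin_iff.2 ⟨hc.mono_left nhdsWithin_le_nhds, ?_⟩
      filter_upwards [self_mem_nhdsWithin] with t ht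
      simpa using (ht : t < 0).ne
    exact this.frequently hneg.frequently
  have hz := ha.frequently_zero_iff_eventually_zero.1 hfr
  obtain ⟨t, h1, h2⟩ := (((hc.eventually hz).filter_mono (nhdsWithin_le_nhds (s := Ioi 0))).and
    hpos).exists
  exact h2 h1

end Holomorphic

/-! ### Complexifications -/

namespace Complexification

variable {E F : Type*} [AddCommGroup E] [Module ℝ E] [TopologicalSpace E]
  [AddCommGroup F] [Module ℝ F] [TopologicalSpace F]

instance [IsTopologicalAddGroup E] : IsTopologicalAddGroup (Complexification E) :=
  inferInstanceAs (IsTopologicalAddGroup (E × E))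

instance [IsTopologicalAddGroup E] [ContinuousSMul ℝ E] :
    ContinuousSMul ℂ (Complexification E) := by
  constructor
  change Continuous fun p : ℂ × (E × E) =>
    ((p.1.re • p.2.1 - p.1.im • p.2.2, p.1.re • p.2.2 + p.1.im • p.2.1) : E × E)
  have h1 : Continuous fun p : ℂ × (E × E) => p.1.re := Complex.continuous_re.comp continuous_fst
  have h2 : Continuous fun p : ℂ × (E × E) => p.1.im := Complex.continuous_im.comp continuous_fst
  fun_prop

/-- The real part. -/
def re {E : Type*} (w : Complexification E) : E := Prod.fst (α := E) (β := E) w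

/-- The imaginary part. -/
def im {E : Type*} (w : Complexification E) : E := Prod.snd (α := E) (β := E) w

/-- The element `u + i v`. -/
def mk {E : Type*} (u v : E) : Complexification E := ((u, v) : E × E)

@[simp] theorem re_mk {E : Type*} (u v : E) : re (mk u v) = u := rfl
@[simp] theorem im_mk {E : Type*} (u v : E) : im (mk u v) = v := rfl
@[simp] theorem re_ofReal {E : Type*} [Zero E] (x : E) : re (ofReal x) = x := rfl
@[simp] theorem im_ofReal {E : Type*} [Zero E] (x : E) : im (ofReal x) = 0 := rfl

@[ext] theorem ext {E : Type*} {w w' : Complexification E} (h : re w = re w') (h' : im w = im w') :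
    w = w' := Prod.ext (α := E) (β := E) h h'

@[simp] theorem re_add {E : Type*} [AddCommGroup E] (w w' : Complexification E) :
    re (w + w') = re w + re w' := rfl
@[simp] theorem im_add {E : Type*} [AddCommGroup E] (w w' : Complexification E) :
    im (w + w') = im w + im w' := rfl
@[simp] theorem re_sub {E : Type*} [AddCommGroup E] (w w' : Complexification E) :
    re (w - w') = re w - re w' := rfl
@[simp] theorem re_smul {E : Type*} [AddCommGroup E] [Module ℝ E] (c : ℂ)
    (w : Complexification E) : re (c • w) = c.re • re w - c.im • im w := rfl
@[simp] theorem im_smul {E : Type*} [AddCommGroup E] [Module ℝ E] (c : ℂ)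
    (w : Complexification E) : im (c • w) = c.re • im w + c.im • re w := rfl

theorem ofReal_add_smul {E : Type*} [AddCommGroup E] [Module ℝ E] (x y : E) (t : ℝ) :
    (ofReal x + (t : ℂ) • ofReal y : Complexification E) = ofReal (x + t • y) :=
  ext (by simp [-Complex.coe_smul]) (by simp [-Complex.coe_smul])

theorem continuous_ofReal {E : Type*} [Zero E] [TopologicalSpace E] :
    Continuous (ofReal : E → Complexification E) :=
  show Continuous fun x : E => ((x, 0) : E × E) by fun_prop

theorem continuous_re {E : Type*} [TopologicalSpace E] :
    Continuous (re : Complexification E → E) :=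
  show Continuous fun w : E × E => w.1 by fun_prop

/-- The complexification of a continuous linear map. -/
def map (L : E →L[ℝ] F) : Complexification E →L[ℂ] Complexification F where
  toFun w := mk (L (re w)) (L (im w))
  map_add' w w' := ext (by simp) (by simp)
  map_smul' c w := ext (by simp) (by simp)
  cont := show Continuous fun w : E × E => ((L w.1, L w.2) : F × F) by fun_prop

@[simp] theorem map_ofReal (L : E →L[ℝ] F) (x : E) : map L (ofReal x) = ofReal (L x) :=
  ext rfl (map_zero L)

/-- The complex linear extension of a continuous linear functional. -/
def functional (L : E →L[ℝ] ℝ) : Complexification E →L[ℂ] ℂ where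
  toFun w := ⟨L (re w), L (im w)⟩
  map_add' w w' := Complex.ext (by simp) (by simp)
  map_smul' c w := Complex.ext (by simp) (by simp)
  cont := by
    have : Continuous fun w : E × E => Complex.equivRealProdCLM.symm (L w.1, L w.2) := by fun_prop
    exact this

@[simp] theorem functional_ofReal (L : E →L[ℝ] ℝ) (x : E) :
    functional L (ofReal x) = (L x : ℂ) := by
  apply Complex.ext
  · rfl
  · exact map_zero L

/-- The identification of the product of the complexifications with the complexification of the
product. -/
def pair : Complexification E × Complexification F →L[ℂ] Complexification (E × F) where
  toFun p := mk (re p.1, re p.2) (im p.1, im p.2)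
  map_add' _ _ := rfl
  map_smul' _ _ := rfl
  cont := show Continuous fun p : (E × E) × (F × F) =>
    (((p.1.1, p.2.1), (p.1.2, p.2.2)) : (E × F) × (E × F)) by fun_prop

@[simp] theorem pair_ofReal (x : E) (y : F) : pair (ofReal x, ofReal y) = ofReal (x, y) := rfl

end Complexification

/-! ### Real analytic maps and their holomorphic extensions -/

section RealAnalytic

open Complexification

variable {E F : Type*} [AddCommGroup E] [Module ℝ E] [TopologicalSpace E]
  [AddCommGroup F] [Module ℝ F] [TopologicalSpace F]
  [IsTopologicalAddGroup E] [ContinuousSMul ℝ E]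

/-- The restriction of a holomorphic extension is continuously differentiable. -/
theorem HasDirDerivOn.restrict_real {f : E → F} {U : Set E} (hU : IsOpen U)
    {g : Complexification E → Complexification F}
    {d : Complexification E → Complexification E → Complexification F}
    {V : Set (Complexification E)} (hg : HasDirDerivOn ℂ g d V)
    (hfg : ∀ x ∈ U, ofReal x ∈ V ∧ g (ofReal x) = ofReal (f x)) :
    HasDirDerivOn ℝ f (fun x y => re (d (ofReal x) (ofReal y))) U := by
  have hc : HasDirDerivOn ℝ (fun x => re (g (ofReal x)))
      (fun x y => re (d (ofReal x) (ofReal y))) U := by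
    refine ⟨hU, ?_, fun x hx y => ?_, ?_⟩
    · exact continuous_re.comp_continuousOn
        (hg.continuousOn.comp continuous_ofReal.continuousOn fun x hx => (hfg x hx).1)
    · have h1 := hg.tendsto _ (hfg x hx).1 (ofReal y)
      have h2 : Tendsto (fun t : ℝ => (t : ℂ)) (𝓝[≠] 0) (𝓝[≠] 0) := by
        refine tendsto_nhdsWithin_iff.2 ⟨?_, ?_⟩
        · simpa using (Complex.continuous_ofReal.tendsto 0).mono_left nhdsWithin_le_nhds
        · filter_upwards [self_mem_nhdsWithin] with t ht
          simpa using ht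
      refine ((continuous_re.tendsto _).comp (h1.comp h2)).congr fun t => ?_
      simp only [Function.comp, ofReal_add_smul, ← Complex.ofReal_inv, re_smul, re_sub,
        Complex.ofReal_re, Complex.ofReal_im, zero_smul, sub_zero]
    · exact continuous_re.comp_continuousOn
        (hg.continuousOn_deriv.comp (f := fun p : E × E => (ofReal p.1, ofReal p.2))
          ((continuous_ofReal.comp continuous_fst).prodMk
            (continuous_ofReal.comp continuous_snd)).continuousOn
          fun p hp => ⟨(hfg _ hp.1).1, mem_univ _⟩)
  exact hc.congr fun x hx => by simp [(hfg x hx).2]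

/-- A real analytic map is analytic along lines. -/
theorem RealAnalyticOn.exists_analyticAt_line {f : E → F} {U : Set E} (hU : IsOpen U)
    (h : RealAnalyticOn f U) {x : E} (hx : x ∈ U) (y : E) (L : F →L[ℝ] ℝ) :
    ∃ g : ℂ → ℂ, AnalyticAt ℂ g 0 ∧ ∀ᶠ t : ℝ in 𝓝 0, g t = L (f (x + t • y)) := by
  obtain ⟨V, g, hfg, hg⟩ := h
  obtain ⟨d, hd⟩ := hg.exists_hasDirDerivOn
  refine ⟨fun ζ => functional L (g (ofReal x + ζ • ofReal y)),
    (hd.clm_comp (functional L)).analyticAt_line (hfg x hx).1 _, ?_⟩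
  filter_upwards [(tendsto_add_smul x y).eventually (hU.mem_nhds hx)] with t ht
  rw [ofReal_add_smul, (hfg _ ht).2, functional_ofReal]

end RealAnalytic

/-! ### Supertranslations as a topological vector space -/

/-- The target of a stereographic chart is the whole plane, so the derivatives in the chart are
defined and continuous everywhere. -/
theorem contDiff_comp_chart_symm (α : Supertranslation) (v : Sphere) :
    ContDiff ℝ ∞ (fun x => α ((chartAt (EuclideanSpace ℝ (Fin 2)) v).symm x)) := by
  have : Fact (Module.finrank ℝ (EuclideanSpace ℝ (Fin 3)) = 2 + 1) := ⟨by simp⟩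
  have h1 : ContMDiffOn (𝓡 2) (𝓡 2) ∞ (chartAt (EuclideanSpace ℝ (Fin 2)) v).symm
      (chartAt (EuclideanSpace ℝ (Fin 2)) v).target := contMDiffOn_chart_symm
  have h2 : (chartAt (EuclideanSpace ℝ (Fin 2)) v).target = univ := stereographic'_target _
  rw [h2, contMDiffOn_univ] at h1
  exact (α.contMDiff.comp h1).contDiff

/-- The derivatives of order `k` of a supertranslation in a stereographic chart. -/
noncomputable def chartDeriv (v : Sphere) (k : ℕ) : Supertranslation →ₗ[ℝ]
    (EuclideanSpace ℝ (Fin 2) → EuclideanSpace ℝ (Fin 2) [×k]→L[ℝ] ℝ) where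
  toFun α := iteratedFDeriv ℝ k (fun x => α ((chartAt (EuclideanSpace ℝ (Fin 2)) v).symm x))
  map_add' α β := iteratedFDeriv_add
    ((contDiff_comp_chart_symm α v).of_le (mod_cast le_top))
    ((contDiff_comp_chart_symm β v).of_le (mod_cast le_top))
  map_smul' _ α := funext fun _ => iteratedFDeriv_const_smul_apply
    ((contDiff_comp_chart_symm α v).of_le (mod_cast le_top)).contDiffAt

/-- The topology of uniform convergence on compact sets of the derivatives of order `k` in a
stereographic chart. -/
noncomputable abbrev chartTopology (v : Sphere) (k : ℕ) : TopologicalSpace Supertranslation :=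
  TopologicalSpace.induced (UniformOnFun.ofFun {C | IsCompact C} ∘ chartDeriv v k) inferInstance

instance : IsTopologicalAddGroup Supertranslation := by
  refine topologicalAddGroup_iInf fun v => topologicalAddGroup_iInf fun k => ?_
  let f : Supertranslation →+ UniformOnFun (EuclideanSpace ℝ (Fin 2))
      (EuclideanSpace ℝ (Fin 2) [×k]→L[ℝ] ℝ) {C | IsCompact C} :=
    { toFun := UniformOnFun.ofFun {C | IsCompact C} ∘ chartDeriv v k
      map_zero' := congrArg (UniformOnFun.ofFun {C | IsCompact C}) (map_zero (chartDeriv v k))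
      map_add' := fun α β =>
        congrArg (UniformOnFun.ofFun {C | IsCompact C}) (map_add (chartDeriv v k) α β) }
  exact topologicalAddGroup_induced f

/-- For uniform convergence on compact sets, scalar multiplication is continuous only on functions
that are bounded on compact sets. Here these functions are continuous derivatives, so the images of
compact sets are compact. -/
instance : ContinuousSMul ℝ Supertranslation := by
  refine continuousSMul_iInf fun v => continuousSMul_iInf fun k => ?_
  let : TopologicalSpace Supertranslation := chartTopology v k
  refine UniformOnFun.continuousSMul_induced_of_image_bounded ℝ _ _ Supertranslation
    (chartDeriv v k) (𝔖 := {C | IsCompact C}) ⟨rfl⟩ fun α C hC => ?_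
  have hC' : IsCompact C := hC
  exact (hC'.image ((contDiff_comp_chart_symm α v).continuous_iteratedFDeriv
    (mod_cast le_top))).isVonNBounded ℝ

/-- Evaluation at a point of the sphere. -/
noncomputable def eval (z : Sphere) : Supertranslation →L[ℝ] ℝ where
  toFun α := α z
  map_add' _ _ := rfl
  map_smul' _ _ := rfl
  cont := by
    set x := chartAt (EuclideanSpace ℝ (Fin 2)) z z with hx
    have h1 : Continuous[chartTopology z 0, inferInstance] fun α : Supertranslation => α z := by
      have h2 : Continuous[chartTopology z 0, inferInstance]
          (UniformOnFun.ofFun {C | IsCompact C} ∘ chartDeriv z 0) := continuous_induced_dom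
      have h3 := (UniformOnFun.uniformContinuous_eval_of_mem
        (EuclideanSpace ℝ (Fin 2) [×0]→L[ℝ] ℝ) {C : Set (EuclideanSpace ℝ (Fin 2)) | IsCompact C}
        (mem_singleton x) isCompact_singleton).continuous
      have h4 : Continuous fun m : EuclideanSpace ℝ (Fin 2) [×0]→L[ℝ] ℝ => m 0 :=
        continuous_eval_const _
      let := chartTopology z 0
      have h5 := h4.comp (h3.comp h2)
      refine h5.congr fun α => ?_
      change α ((chartAt (EuclideanSpace ℝ (Fin 2)) z).symm x) = α z
      rw [hx, OpenPartialHomeomorph.left_inv _ (mem_chart_source _ z)]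
    exact continuous_iInf_dom (i := z) (continuous_iInf_dom (i := 0) h1)

@[simp] theorem eval_apply (z : Sphere) (α : Supertranslation) : eval z α = α z := rfl

/-! ### A supertranslation supported in a hemisphere -/

/-- The smooth function `exp (-1 / x)` of the first coordinate `x` on the hemisphere `x > 0`,
extended by `0`. -/
noncomputable def hemisphereBump : Supertranslation :=
  ⟨fun z => expNegInvGlue (z.1 0), by
    have : Fact (Module.finrank ℝ (EuclideanSpace ℝ (Fin 3)) = 2 + 1) := ⟨by simp⟩
    have h : ContDiff ℝ ∞ fun x : EuclideanSpace ℝ (Fin 3) => expNegInvGlue (x 0) :=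
      expNegInvGlue.contDiff.comp (by fun_prop)
    exact h.contMDiff.comp contMDiff_coe_sphere⟩

/-- The north pole, which lies on the boundary of the hemisphere. -/
noncomputable def northPole : Sphere := kappa.symm OnePoint.infty

/-- With `p = (a, b, c)`, the pole `[1 : 0]` is sent to `[a : c]`, whose first coordinate on the
sphere is 2 Re(a c̄) / (|a|² + |c|²). The conformal factor is positive, so only the sign of Re(a c̄)
matters. -/
theorem sigma_northPole_eq_zero_iff (p : ℂ × ℂ × ℂ) (hp : p.1 ≠ 0) :
    sigma hemisphereBump (lorChartInv p) northPole = 0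
      ↔ p.1.re * p.2.2.re + p.1.im * p.2.2.im ≤ 0 := by
  have hpos := normSq_add_pos (q := p.2.2) (Or.inl hp)
  have hK : (confFactor (lorChartInv p) northPole)⁻¹ ≠ 0 := by
    rw [lorChartInv_of_ne hp, confFactor_mk]
    exact inv_ne_zero (slFactor_pos _ _).ne'
  have hx : (lorAct (lorChartInv p) northPole).1 0
      = 2 * (p.1.re * p.2.2.re + p.1.im * p.2.2.im)
        / (Complex.normSq p.1 + Complex.normSq p.2.2) := by
    rw [lorChartInv_of_ne hp, lorAct_mk, slAct_val]
    simp [northPole, homCoord, slOfEntries, hopf]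
  rw [sigma_apply, mul_eq_zero, or_iff_right hK]
  change expNegInvGlue ((lorAct (lorChartInv p) northPole).1 0) = 0 ↔ _
  rw [expNegInvGlue.zero_iff_nonpos, hx, div_le_iff₀ hpos]
  constructor <;> intro h <;> linarith

open Complexification

/-! ### Derivatives of conjugations -/

theorem HasDirDerivOn.of_contDiff {E : Type*} [NormedAddCommGroup E] [NormedSpace ℝ E] {f : E → ℝ}
    (hf : ContDiff ℝ 1 f) : HasDirDerivOn ℝ f (fun x y => fderiv ℝ f x y) univ := by
  refine ⟨isOpen_univ, hf.continuous.continuousOn, fun x _ y => ?_, ?_⟩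
  · exact ((hf.differentiable one_ne_zero x).hasFDerivAt.hasLineDerivAt y).tendsto_slope_zero
  · exact (hf.continuous_fderiv_apply one_ne_zero).continuousOn

section Conjugation

variable {E : Type*} [AddCommGroup E] [Module ℝ E] [TopologicalSpace E]
  [IsTopologicalAddGroup E] [ContinuousSMul ℝ E]

/-- At real points and in real directions, the complex derivative can be computed with real `t`
only, where its difference quotients are those of `f`. -/
theorem HasDirDerivOn.deriv_ofReal {f : E → ℝ} {df : E → E → ℝ} {U : Set E}
    (hf : HasDirDerivOn ℝ f df U) {g : Complexification E → ℂ}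
    {dg : Complexification E → Complexification E → ℂ} {V : Set (Complexification E)}
    (hg : HasDirDerivOn ℂ g dg V) (hfg : ∀ x ∈ U, ofReal x ∈ V ∧ g (ofReal x) = (f x : ℂ))
    {x : E} (hx : x ∈ U) (y : E) : dg (ofReal x) (ofReal y) = (df x y : ℂ) := by
  have h1 : Tendsto (fun t : ℝ => (t : ℂ)) (𝓝[≠] 0) (𝓝[≠] 0) := by
    refine tendsto_nhdsWithin_iff.2 ⟨?_, ?_⟩
    · simpa using (Complex.continuous_ofReal.tendsto 0).mono_left nhdsWithin_le_nhds
    · filter_upwards [self_mem_nhdsWithin] with t ht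
      simpa using ht
  refine tendsto_nhds_unique ((hg.tendsto _ (hfg x hx).1 (ofReal y)).comp h1) ?_
  refine ((Complex.continuous_ofReal.tendsto _).comp (hf.tendsto x hx y)).congr' ?_
  have hev : ∀ᶠ t : ℝ in 𝓝[≠] 0, x + t • y ∈ U :=
    nhdsWithin_le_nhds ((tendsto_add_smul x y).eventually (hf.isOpen.mem_nhds hx))
  filter_upwards [hev] with t ht
  simp only [Function.comp, ofReal_add_smul, (hfg _ ht).2, (hfg _ hx).2, smul_eq_mul]
  push_cast
  rfl

/-- Let `m` and `i` be real analytic maps, for instance the multiplication and the inversion of a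
Lie group in a chart, such that `m (m (y, x₀), i y) = x₀`. The derivative of
`x ↦ m (m (y, x), i y)` at `x₀` depends analytically on `y`. Here the derivative is computed in a
smooth coordinate `μ` and along a curve. -/
theorem exists_analyticAt_deriv_conj {m : E × E → E} {i : E → E} {U : Set (E × E)} {U' W : Set E}
    (hU : IsOpen U) (hU' : IsOpen U') (hm : RealAnalyticOn m U) (hi : RealAnalyticOn i U')
    {μ : E → ℝ} {dμ : E → E → ℝ} (hμ : HasDirDerivOn ℝ μ dμ W) {x₀ ξ w : E}
    (hx₀ : x₀ ∈ U') (hx₀U : (x₀, x₀) ∈ U) (hx₀W : x₀ ∈ W) (hm₀ : m (x₀, x₀) = x₀) (hi₀ : i x₀ = x₀)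
    (hconj : ∀ y, (y, x₀) ∈ U → y ∈ U' → (m (y, x₀), i y) ∈ U → m (m (y, x₀), i y) = x₀)
    {q : ℝ → E} (hq : Tendsto q (𝓝[≠] 0) (𝓝 w)) :
    ∃ g : ℂ → ℂ, AnalyticAt ℂ g 0 ∧ ∀ᶠ t : ℝ in 𝓝 0, ∃ r : ℝ, g t = r ∧
      Tendsto (fun s => s⁻¹ * (μ (m (m (x₀ + t • ξ, x₀ + s • q s), i (x₀ + t • ξ))) - μ x₀))
        (𝓝[≠] 0) (𝓝 r) ∧
      ∀ᶠ s in 𝓝[≠] 0, (x₀ + t • ξ, x₀ + s • q s) ∈ U ∧ x₀ + t • ξ ∈ U' ∧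
        (m (x₀ + t • ξ, x₀ + s • q s), i (x₀ + t • ξ)) ∈ U := by
  obtain ⟨V, M, hMm, hMs⟩ := hm
  obtain ⟨V', I, hIi, hIs⟩ := hi
  obtain ⟨dM, hM⟩ := hMs.exists_hasDirDerivOn
  obtain ⟨dI, hI⟩ := hIs.exists_hasDirDerivOn
  obtain ⟨dm, rm⟩ : ∃ dm, HasDirDerivOn ℝ m dm U := ⟨_, hM.restrict_real hU hMm⟩
  obtain ⟨di, ri⟩ : ∃ di, HasDirDerivOn ℝ i di U' := ⟨_, hI.restrict_real hU' hIi⟩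
  set O : Set (E × E) := U ∩ Prod.fst ⁻¹' U'
  have hO : IsOpen O := hU.inter (hU'.preimage continuous_fst)
  -- With `P = (y, x)`, the conjugation `m (m (y, x), i y)` is `m (κ P)`.
  set κ : E × E → E × E := fun P => (m P, i P.1) with hκ
  obtain ⟨dκ, rκ⟩ : ∃ dκ, HasDirDerivOn ℝ κ dκ O :=
    ⟨_, (rm.mono hO inter_subset_left).prodMk
      ((ri.comp_clm (ContinuousLinearMap.fst ℝ E E)).mono hO inter_subset_right)⟩
  -- `μ` has no holomorphic extension in general, but its derivative `L` at `x₀` extends complex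
  -- linearly. Below, `hA` differentiates `L ∘ m ∘ κ`, `hB` differentiates `μ ∘ m ∘ κ`, and `hC`
  -- differentiates the holomorphic extension of the former.
  obtain ⟨L, hL⟩ := hμ.exists_clm hx₀W
  have hA := (rm.clm_comp L).comp rκ
  have hB := (hμ.comp rm).comp rκ
  have hVo : IsOpen (V ∩ Complexification.map (ContinuousLinearMap.fst ℝ E E) ⁻¹' V') :=
    hM.isOpen.inter (hI.isOpen.preimage (Complexification.map (ContinuousLinearMap.fst ℝ E E)).continuous)
  have hC := (hM.clm_comp (functional L)).comp
    (((hM.mono hVo inter_subset_left).prodMk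
      ((hI.comp_clm (Complexification.map (ContinuousLinearMap.fst ℝ E E))).mono hVo inter_subset_right)).clm_comp
        (pair (E := E) (F := E)))
  have hreal : ∀ P ∈ O ∩ κ ⁻¹' U, _ ∧ _ := fun P hP => by
    have h1 := hMm P hP.1.1
    have h2 := hIi P.1 hP.1.2
    have h3 := hMm _ hP.2
    have e : pair (M (ofReal P), I (Complexification.map (ContinuousLinearMap.fst ℝ E E) (ofReal P)))
        = ofReal (κ P) := by
      rw [h1.2, map_ofReal, ContinuousLinearMap.coe_fst', h2.2, pair_ofReal]
    -- The placeholders in the statement of `hreal` are fixed here: the real point lies in the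
    -- domain of `hC`, and the extension takes the value `L (m (κ P))` there.
    refine And.intro (a := ofReal P ∈ V ∩ Complexification.map (ContinuousLinearMap.fst ℝ E E) ⁻¹' V' ∩
      (fun x => pair (M x, I (Complexification.map (ContinuousLinearMap.fst ℝ E E) x))) ⁻¹' V)
      (b := functional L (M (pair (M (ofReal P),
        I (Complexification.map (ContinuousLinearMap.fst ℝ E E) (ofReal P))))) = ((L (m (κ P)) : ℝ) : ℂ))
      ⟨⟨h1.1, ?_⟩, ?_⟩ ?_
    · change Complexification.map (ContinuousLinearMap.fst ℝ E E) (ofReal P) ∈ V'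
      rw [map_ofReal]
      exact h2.1
    · change pair (M (ofReal P), I (Complexification.map (ContinuousLinearMap.fst ℝ E E) (ofReal P))) ∈ V
      rw [e]
      exact h3.1
    · rw [e, h3.2, functional_ofReal]
  have hP₀ : (x₀, x₀) ∈ O ∩ κ ⁻¹' U := by
    refine ⟨⟨hx₀U, hx₀⟩, ?_⟩
    change (m (x₀, x₀), i x₀) ∈ U
    rw [hm₀, hi₀]
    exact hx₀U
  refine ⟨_, hC.analyticAt_deriv_line (hreal _ hP₀).1 (ofReal (ξ, 0)) (ofReal (0, w)), ?_⟩
  have hline : ∀ t : ℝ, (x₀, x₀) + t • (ξ, (0 : E)) = (x₀ + t • ξ, x₀) := fun t => by simp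
  filter_upwards [(tendsto_add_smul (x₀, x₀) (ξ, (0 : E))).eventually (hA.isOpen.mem_nhds hP₀)]
    with t ht
  have hd := hA.deriv_ofReal hC hreal ht (0, w)
  rw [← ofReal_add_smul] at hd
  refine ⟨_, hd, ?_⟩
  rw [hline] at ht ⊢
  -- Conjugation fixes `x₀`, so the derivative of `μ` is taken at `x₀` for every `t`, where it is
  -- `L`. Hence `hA` and `hB` give the same derivative in the direction `(0, w)`.
  have hx : m (κ (x₀ + t • ξ, x₀)) = x₀ := hconj _ ht.1.1 ht.1.2 ht.2
  have hstep : ∀ s : ℝ, (x₀ + t • ξ, x₀) + s • ((0 : E), q s) = (x₀ + t • ξ, x₀ + s • q s) :=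
    fun s => by simp
  have hq' : Tendsto (fun s => ((0 : E), q s)) (𝓝[≠] 0) (𝓝 (0, w)) :=
    tendsto_const_nhds.prodMk_nhds hq
  constructor
  · have hlim := hB.tendsto_quotient (l := 𝓝[≠] (0 : ℝ)) (p := fun _ => (x₀ + t • ξ, x₀))
      (q := fun s => (0, q s)) (t := fun s => s)
      ⟨ht.1, ht.2, by rw [mem_preimage, hx]; exact hx₀W⟩ tendsto_const_nhds hq' tendsto_id
    simp only [hx, hstep, ← hL] at hlim
    exact hlim
  · have hlim : Tendsto (fun s : ℝ => (x₀ + t • ξ, x₀) + s • ((0 : E), q s)) (𝓝[≠] 0)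
        (𝓝 (x₀ + t • ξ, x₀)) := by
      have : Tendsto (fun s : ℝ => s) (𝓝[≠] 0) (𝓝 0) := nhdsWithin_le_nhds
      simpa using (tendsto_const_nhds (x := (x₀ + t • ξ, x₀))).add (this.smul hq')
    filter_upwards [hlim.eventually (hA.isOpen.mem_nhds ht)] with s hs
    rw [hstep] at hs
    exact ⟨hs.1.1, hs.1.2, hs.2⟩

end Conjugation

/-! ### Charts at the identity -/

/-- The chart of the Lorentz group at the identity. -/
noncomputable def lorChartOne : OpenPartialHomeomorph Lor (ℂ × ℂ × ℂ) :=
  (Homeomorph.mulLeft (1 : Lor)).transOpenPartialHomeomorph lorChart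

theorem lorChartOne_mem : lorChartOne ∈ lorAtlas := ⟨1, rfl⟩

theorem lorChartOne_apply (f : Lor) : lorChartOne f = lorChartFun f :=
  congrArg lorChartFun (one_mul f)

theorem lorChartOne_symm_apply (p : ℂ × ℂ × ℂ) : lorChartOne.symm p = lorChartInv p := by
  change (1 : Lor)⁻¹ * lorChartInv p = _
  rw [inv_one, one_mul]

theorem mem_lorChartOne_source {f : Lor} : f ∈ lorChartOne.source ↔ 0 < (lorChartFun f).1.re := by
  change 0 < (lorChartFun (1 * f)).1.re ↔ _
  rw [one_mul]

theorem lorChartFun_one : lorChartFun 1 = (1, 0, 0) := by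
  have h : (0 : ℝ) < ((1 : SL(2, ℂ)) 0 0).re := by simp
  exact (lorChartFun_mk_of_pos h).trans (by simp)

theorem lorChartInv_one : lorChartInv (1, 0, 0) = 1 := by
  have h : (1 : Lor) ∈ lorChart.source := by
    change 0 < (lorChartFun 1).1.re
    simp [lorChartFun_one]
  have h' : lorChartInv (lorChartFun 1) = 1 := lorChart.left_inv h
  rwa [lorChartFun_one] at h'

/-- The standard chart of the BMS group at the identity. -/
noncomputable def bmsChart : OpenPartialHomeomorph BMSGroup BMSModel :=
  (OpenPartialHomeomorph.refl Supertranslation).prod lorChartOne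

theorem bmsChart_mem : bmsChart ∈ bmsAtlas := ⟨_, rfl, _, lorChartOne_mem, rfl⟩

theorem bmsChart_apply (x : BMSGroup) : bmsChart x = (x.1, lorChartFun x.2) :=
  Prod.ext rfl (lorChartOne_apply x.2)

theorem bmsChart_symm_apply (p : BMSModel) :
    bmsChart.symm p = ((p.1, lorChartInv p.2) : Supertranslation × Lor) :=
  Prod.ext rfl (lorChartOne_symm_apply p.2)

theorem mem_bmsChart_source {x : BMSGroup} :
    x ∈ bmsChart.source ↔ 0 < (lorChartFun x.2).1.re := by
  change x.1 ∈ univ ∧ x.2 ∈ lorChartOne.source ↔ _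
  rw [mem_lorChartOne_source]
  exact and_iff_right (mem_univ _)

theorem mem_bmsChart_target {p : BMSModel} : p ∈ bmsChart.target ↔ 0 < p.2.1.re := by
  change p.1 ∈ univ ∧ p.2 ∈ lorChartOne.target ↔ _
  exact and_iff_right (mem_univ _)

theorem one_mem_bmsChart_source : (1 : BMSGroup) ∈ bmsChart.source := by
  rw [mem_bmsChart_source]
  change 0 < (lorChartFun 1).1.re
  simp [lorChartFun_one]

theorem bmsChart_one : bmsChart 1 = (0, (1, 0, 0)) := by
  rw [bmsChart_apply]
  exact Prod.ext rfl lorChartFun_one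

theorem isOpen_chart_domain {M N E F : Type*} [TopologicalSpace M] [TopologicalSpace N]
    [TopologicalSpace E] [TopologicalSpace F] (e : OpenPartialHomeomorph M E)
    (e' : OpenPartialHomeomorph N F) {f : M → N} (hf : Continuous f) :
    IsOpen (e.target ∩ e.symm ⁻¹' (f ⁻¹' e'.source)) :=
  e.continuousOn_symm.isOpen_inter_preimage e.open_target (e'.open_source.preimage hf)

/-! ### The failure of analyticity -/

/-- Along a curve of Lorentz transformations which moves the north pole into the hemisphere, the
transformed supertranslation is not analytic at the north pole. -/
theorem not_analyticAt_of_sigma {g : ℂ → ℂ} {p : ℝ → ℂ × ℂ × ℂ}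
    (hp : ∀ᶠ t in 𝓝 0, (p t).1 ≠ 0)
    (hR : Tendsto (fun t => t⁻¹ * ((p t).1.re * (p t).2.2.re + (p t).1.im * (p t).2.2.im))
      (𝓝[≠] 0) (𝓝 1))
    (hg : ∀ᶠ t : ℝ in 𝓝 0, g t = (sigma hemisphereBump (lorChartInv (p t)) northPole : ℝ)) :
    ¬ AnalyticAt ℂ g 0 := by
  -- Near `0`, the quantity Re(a c̄) has the sign of `t`. Only this first-order information on the
  -- curve is used, which permits curves known only up to tangency.
  have hpos : ∀ᶠ t in 𝓝[≠] 0,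
      0 < t⁻¹ * ((p t).1.re * (p t).2.2.re + (p t).1.im * (p t).2.2.im) :=
    hR.eventually (lt_mem_nhds zero_lt_one)
  apply not_analyticAt_of_one_sided
  · have h1 := hpos.filter_mono (nhdsWithin_mono (0 : ℝ) fun t (ht : t < 0) => ht.ne)
    filter_upwards [h1, nhdsWithin_le_nhds hp, nhdsWithin_le_nhds hg, self_mem_nhdsWithin]
      with t h1 h2 h3 h4
    rw [h3, Complex.ofReal_eq_zero, sigma_northPole_eq_zero_iff _ h2]
    exact (neg_of_mul_pos_right h1 (inv_lt_zero.2 h4).le).le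
  · have h1 := hpos.filter_mono (nhdsWithin_mono (0 : ℝ) fun t (ht : 0 < t) => ht.ne')
    filter_upwards [h1, nhdsWithin_le_nhds hp, nhdsWithin_le_nhds hg, self_mem_nhdsWithin]
      with t h1 h2 h3 h4
    rw [h3, Ne, Complex.ofReal_eq_zero, sigma_northPole_eq_zero_iff _ h2, not_le]
    exact pos_of_mul_pos_right h1 (inv_pos.2 h4).le

/-- For the matrices (1, 0; t, 1) one has Re(a c̄) = t. -/
theorem not_analyticAt_of_sigma_line {g : ℂ → ℂ}
    (hg : ∀ᶠ t : ℝ in 𝓝 0,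
      g t = (sigma hemisphereBump (lorChartInv (1, 0, (t : ℂ))) northPole : ℝ)) :
    ¬ AnalyticAt ℂ g 0 := by
  refine not_analyticAt_of_sigma (p := fun t => (1, 0, (t : ℂ))) (by simp) ?_ hg
  refine tendsto_const_nhds.congr' ?_
  filter_upwards [self_mem_nhdsWithin] with t ht
  have : t ≠ 0 := ht
  simp [this]

theorem not_realAnalyticMap_sigma :
    ¬ RealAnalyticMap (prodAtlas (modelAtlas Supertranslation) lorAtlas)
      (modelAtlas Supertranslation) (fun p : Supertranslation × Lor => sigma p.1 p.2) := by
  rintro ⟨hc, h⟩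
  have h1 := h ((OpenPartialHomeomorph.refl Supertranslation).prod lorChartOne)
    ⟨_, rfl, _, lorChartOne_mem, rfl⟩ (OpenPartialHomeomorph.refl _) rfl
  obtain ⟨g, hg, hgt⟩ := h1.exists_analyticAt_line (isOpen_chart_domain _ _ hc)
    (x := (hemisphereBump, (1, 0, 0)))
    ⟨mem_bmsChart_target.2 (by simp), mem_univ _⟩ (0, (0, 0, 1)) (eval northPole)
  refine not_analyticAt_of_sigma_line ?_ hg
  filter_upwards [hgt] with t ht
  rw [ht]
  change ((sigma (hemisphereBump + t • 0) (lorChartOne.symm _) northPole : ℝ) : ℂ) = _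
  rw [lorChartOne_symm_apply]
  simp

/-- The action is contained in the multiplication: (0, f_t)(α, 1) = (σ(α, f_t), f_t), and the pair
of factors runs along a straight line of the product chart. -/
theorem not_realAnalyticMap_mul :
    ¬ RealAnalyticMap (prodAtlas bmsAtlas bmsAtlas) bmsAtlas
      (fun p : BMSGroup × BMSGroup => p.1 * p.2) := by
  rintro ⟨hc, h⟩
  have h1 := h (bmsChart.prod bmsChart) ⟨_, bmsChart_mem, _, bmsChart_mem, rfl⟩ bmsChart
    bmsChart_mem
  have hs : ∀ p : BMSModel × BMSModel, (bmsChart.prod bmsChart).symm p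
      = (bmsChart.symm p.1, bmsChart.symm p.2) := fun _ => rfl
  obtain ⟨g, hg, hgt⟩ := h1.exists_analyticAt_line (isOpen_chart_domain _ _ hc)
    (x := ((0, (1, 0, 0)), (hemisphereBump, (1, 0, 0)))) (by
      refine ⟨⟨mem_bmsChart_target.2 (by simp), mem_bmsChart_target.2 (by simp)⟩, ?_⟩
      simp only [mem_preimage, hs, bmsChart_symm_apply, lorChartInv_one]
      rw [mem_bmsChart_source]
      change 0 < (lorChartFun (1 * 1)).1.re
      simp [lorChartFun_one])
    ((0, (0, 0, 1)), 0) ((eval northPole).comp (ContinuousLinearMap.fst ℝ _ _))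
  refine not_analyticAt_of_sigma_line ?_ hg
  filter_upwards [hgt] with t ht
  rw [ht, hs, bmsChart_apply, bmsChart_symm_apply, bmsChart_symm_apply]
  change (((0 + t • 0 + sigma (hemisphereBump + t • 0) _ : Supertranslation) northPole : ℝ) : ℂ) = _
  simp

/-- The supertranslations form an abelian normal subgroup, on which conjugation depends only on the
Lorentz part of `G`: the contributions of `G.1` and of the inverse of `G` cancel. -/
theorem conj_apply {G X : BMSGroup} (hX : X.2 = 1) (z : Sphere) :
    (G * X * G⁻¹).1 z = sigma X.1 G.2 z := by
  change G.1 z + sigma X.1 G.2 z + sigma (-sigma G.1 G.2⁻¹) (X.2 * G.2) z = _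
  have e : ∀ (α : Supertranslation) (f : Lor), sigma (-α) f z = -sigma α f z := fun α f => by
    simp [sigma_apply]
  rw [hX, one_mul, e, sigma_sigma, inv_mul_cancel, sigma_one]
  ring

theorem not_isRealAnalyticLieGroup {A : Set (OpenPartialHomeomorph BMSGroup BMSModel)}
    (hA : SmoothlyCompatible A bmsAtlas) : ¬ IsRealAnalyticLieGroup A := by
  intro hLie
  obtain ⟨e, he, h1e⟩ := hLie.atlas.covers 1
  obtain ⟨hτ, hτ'⟩ := hA e he bmsChart bmsChart_mem
  obtain ⟨dτ, hτ⟩ := hτ.exists_hasDirDerivOn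
  obtain ⟨dτ', hτ'⟩ := hτ'.exists_hasDirDerivOn
  set τ : BMSModel → BMSModel := ⇑(e.symm.trans bmsChart)
  set τ' : BMSModel → BMSModel := ⇑(bmsChart.symm.trans e)
  set x₀ : BMSModel := e 1 with hx₀
  set c₀ : BMSModel := (0, (1, 0, 0)) with hc₀
  have hsymm₀ : e.symm x₀ = 1 := e.left_inv h1e
  have hx₀τ : x₀ ∈ (e.symm.trans bmsChart).source := by
    rw [OpenPartialHomeomorph.trans_source]
    refine ⟨e.map_source h1e, ?_⟩
    rw [mem_preimage, hsymm₀]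
    exact one_mem_bmsChart_source
  have hc₀τ' : c₀ ∈ (bmsChart.symm.trans e).source := by
    rw [OpenPartialHomeomorph.trans_source]
    have : c₀ = bmsChart 1 := bmsChart_one.symm
    refine ⟨this ▸ bmsChart.map_source one_mem_bmsChart_source, ?_⟩
    rw [mem_preimage, this, bmsChart.left_inv one_mem_bmsChart_source]
    exact h1e
  have hτ'c₀ : τ' c₀ = x₀ := by
    have : c₀ = bmsChart 1 := bmsChart_one.symm
    change e (bmsChart.symm c₀) = x₀
    rw [this, bmsChart.left_inv one_mem_bmsChart_source]
  have hτx₀ : τ x₀ = c₀ := by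
    change bmsChart (e.symm x₀) = c₀
    rw [hsymm₀, bmsChart_one]
  -- A straight line of the standard chart, seen in the chart `e`, is `x₀ + s • q s` with `q s` the
  -- difference quotient of `τ'`, which tends to `dτ' c₀ η`.
  have hττ' : ∀ η : BMSModel, ∀ᶠ s : ℝ in 𝓝[≠] 0,
      c₀ + s • η ∈ (bmsChart.symm.trans e).source ∧
      x₀ + s • (s⁻¹ • (τ' (c₀ + s • η) - τ' c₀)) = τ' (c₀ + s • η) := fun η => by
    filter_upwards [nhdsWithin_le_nhds
      ((tendsto_add_smul c₀ η).eventually (hτ'.isOpen.mem_nhds hc₀τ')), self_mem_nhdsWithin]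
      with s hs hne
    exact ⟨hs, by rw [smul_inv_smul₀ (show s ≠ 0 from hne), hτ'c₀, add_sub_cancel]⟩
  have hesymm : ∀ c ∈ (bmsChart.symm.trans e).source, e.symm (τ' c) = bmsChart.symm c := by
    intro c hc
    rw [OpenPartialHomeomorph.trans_source] at hc
    exact e.left_inv hc.2
  -- The velocity in the chart `e` of the curve `(0, f_t)`. The line `x₀ + t • ξ` is analytic in `e`
  -- and tangent to that curve.
  set ξ := dτ' c₀ (0, (0, 0, 1)) with hξ
  have hm := hLie.mul.2 (e.prod e) ⟨e, he, e, he, rfl⟩ e he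
  have hi := hLie.inv.2 e he e he
  obtain ⟨g, hg, hgt⟩ := exists_analyticAt_deriv_conj (isOpen_chart_domain (e.prod e) e hLie.mul.1)
    (isOpen_chart_domain e e hLie.inv.1) hm hi
    -- The smooth coordinate `μ` is the value at the north pole of the supertranslation part, read
    -- through `τ`.
    (hτ.clm_comp ((eval northPole).comp (ContinuousLinearMap.fst ℝ _ _)))
    (x₀ := x₀) (ξ := ξ) (w := dτ' c₀ (hemisphereBump, 0))
    (by
      refine ⟨e.map_source h1e, ?_⟩
      simp only [mem_preimage, hsymm₀, inv_one, h1e])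
    (by
      refine ⟨⟨e.map_source h1e, e.map_source h1e⟩, ?_⟩
      simp only [mem_preimage]
      change e.symm x₀ * e.symm x₀ ∈ e.source
      rw [hsymm₀, mul_one]
      exact h1e)
    hx₀τ
    (by
      change e (e.symm x₀ * e.symm x₀) = x₀
      rw [hsymm₀, mul_one])
    (by
      change e (e.symm x₀)⁻¹ = x₀
      rw [hsymm₀, inv_one])
    (by
      intro y hy hy' _
      have h1 : e.symm y * e.symm x₀ ∈ e.source := hy.2
      have h2 : (e.symm y)⁻¹ ∈ e.source := hy'.2
      change e (e.symm (e (e.symm y * e.symm x₀)) * e.symm (e (e.symm y)⁻¹)) = x₀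
      rw [e.left_inv h1, e.left_inv h2, hsymm₀, mul_one, mul_inv_cancel])
    -- With this choice, `x₀ + s • q s` represents the group element `(s • hemisphereBump, 1)` for
    -- small `s ≠ 0`.
    (q := fun s => s⁻¹ • (τ' (c₀ + s • (hemisphereBump, 0)) - τ' c₀))
    (hτ'.tendsto _ hc₀τ' _)
  refine not_analyticAt_of_sigma (p := fun t => (τ (x₀ + t • ξ)).2) ?_ ?_ ?_ hg
  · filter_upwards [(tendsto_add_smul x₀ ξ).eventually (hτ.isOpen.mem_nhds hx₀τ)] with t ht
    have h1 := (e.symm.trans bmsChart).map_source ht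
    rw [OpenPartialHomeomorph.trans_target] at h1
    have h2 := mem_bmsChart_target.1 h1.1
    intro h0
    rw [h0] at h2
    simp at h2
  · have hR : ContDiff ℝ 1 fun p : ℂ × ℂ × ℂ => p.1.re * p.2.2.re + p.1.im * p.2.2.im := by
      have hre : ContDiff ℝ 1 Complex.re := Complex.reCLM.contDiff
      have him : ContDiff ℝ 1 Complex.im := Complex.imCLM.contDiff
      fun_prop
    -- The derivative of Re(a c̄) ∘ `τ` at `x₀` along `ξ` is computed along the curve `τ' (c₀ + s •
    -- (0, (0, 0, 1)))`, which has the same velocity. There `τ` undoes `τ'`, Re(a c̄) equals `s`,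
    -- and the quotient is identically `1`.
    have hRτ := ((HasDirDerivOn.of_contDiff hR).comp_clm
      (ContinuousLinearMap.snd ℝ Supertranslation (ℂ × ℂ × ℂ))).comp hτ
    have hmem : x₀ ∈ (e.symm.trans bmsChart).source ∩ _ := ⟨hx₀τ, mem_univ _⟩
    have h1 := hRτ.tendsto_quotient (l := 𝓝[≠] (0 : ℝ)) (t := fun s => s) (p := fun _ => x₀)
      hmem tendsto_const_nhds (hτ'.tendsto c₀ hc₀τ' (0, (0, 0, 1))) tendsto_id
    have h2 := hRτ.tendsto x₀ hmem ξ
    have h3 := tendsto_nhds_unique (h1.congr' (f₂ := fun _ => (1 : ℝ)) ?_) tendsto_const_nhds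
    · rw [← hξ] at h3
      rw [h3] at h2
      refine h2.congr fun t => ?_
      simp [hτx₀, hc₀]
    · filter_upwards [hττ' (0, (0, 0, 1)), self_mem_nhdsWithin] with s hs hne
      have hne' : s ≠ 0 := hne
      have h4 : τ (τ' (c₀ + s • (0, (0, 0, 1)))) = c₀ + s • (0, (0, 0, 1)) := by
        change bmsChart (e.symm (τ' _)) = _
        rw [hesymm _ hs.1, bmsChart.right_inv]
        exact hs.1.1
      simp only [hs.2, h4, hτx₀]
      simp [hc₀, hne']
  · filter_upwards [hgt, (tendsto_add_smul x₀ ξ).eventually (hτ.isOpen.mem_nhds hx₀τ)]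
      with t ⟨r, hgr, hlim, hev⟩ ht
    rw [hgr, Complex.ofReal_inj]
    -- Conjugation is linear on supertranslations, so the difference quotient in `s` is constant,
    -- equal to the transformed supertranslation at the north pole.
    refine tendsto_nhds_unique hlim (tendsto_const_nhds.congr' ?_)
    filter_upwards [hev, hττ' (hemisphereBump, 0), self_mem_nhdsWithin] with s hs hs' hne
    have hne' : s ≠ 0 := hne
    rw [hs'.2] at hs ⊢
    obtain ⟨h1, h2, h3⟩ := hs
    set G := e.symm (x₀ + t • ξ)
    set X := e.symm (τ' (c₀ + s • (hemisphereBump, 0))) with hX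
    have h1' : G * X ∈ e.source := h1.2
    have h2' : G⁻¹ ∈ e.source := h2.2
    have hX' : X = ((s • hemisphereBump, 1) : Supertranslation × Lor) := by
      rw [hX, hesymm _ hs'.1, bmsChart_symm_apply]
      refine Prod.ext ?_ ?_
      · simp [hc₀]
      · simp [hc₀, lorChartInv_one]
    have h3' : G * X * G⁻¹ ∈ e.source := by
      have : e.symm (e (G * X)) * e.symm (e G⁻¹) ∈ e.source := h3.2
      rwa [e.left_inv h1', e.left_inv h2'] at this
    have hGφ : lorChartInv (τ (x₀ + t • ξ)).2 = G.2 := by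
      have h4 : bmsChart.symm (bmsChart G) = G := bmsChart.left_inv ht.2
      rw [bmsChart_symm_apply] at h4
      exact congrArg (fun x : Supertranslation × Lor => x.2) h4
    have h5 : τ (e (e.symm (e (G * X)) * e.symm (e G⁻¹))) = bmsChart (G * X * G⁻¹) := by
      change bmsChart (e.symm _) = _
      rw [e.left_inv h1', e.left_inv h2', e.left_inv h3']
    have h6 : (τ x₀).1 northPole = 0 := by rw [hτx₀]; rfl
    change _ = s⁻¹ * ((τ (e (e.symm (e (G * X)) * e.symm (e G⁻¹)))).1 northPole
      - (τ x₀).1 northPole)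
    rw [h5, h6, bmsChart_apply, hGφ, conj_apply (by rw [hX']), hX', sub_zero]
    change _ = s⁻¹ * ((confFactor G.2 northPole)⁻¹ * (s * hemisphereBump _))
    rw [sigma_apply]
    field_simp

end BMS

theorem mainTheorem1 :
    (¬ BMS.RealAnalyticMap
        (BMS.prodAtlas (BMS.modelAtlas BMS.Supertranslation) BMS.lorAtlas)
        (BMS.modelAtlas BMS.Supertranslation)
        (fun p : BMS.Supertranslation × BMS.Lor => BMS.sigma p.1 p.2)) ∧
    (¬ BMS.RealAnalyticMap (BMS.prodAtlas BMS.bmsAtlas BMS.bmsAtlas) BMS.bmsAtlas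
        (fun p : BMS.BMSGroup × BMS.BMSGroup => p.1 * p.2)) ∧
    (¬ ∃ A : Set (OpenPartialHomeomorph BMS.BMSGroup BMS.BMSModel),
        BMS.SmoothlyCompatible A BMS.bmsAtlas ∧ BMS.IsRealAnalyticLieGroup A) :=
  ⟨BMS.not_realAnalyticMap_sigma, BMS.not_realAnalyticMap_mul,
    fun ⟨_, hA, hLie⟩ => BMS.not_isRealAnalyticLieGroup hA hLie⟩
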